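/- All graphs are finite and simple. A tree-decomposition of a graph $G$ is a tree $T$ together with a set (bag) $X_t\subseteq V(G)$ for each $t\in V(T)$ such that $\bigcup_{t} X_t=V(G)$, every edge of $G$ has both ends in some bag, and for every $v\in V(G)$ the set $\{t: v\in X_t\}$ induces a connected subgraph of $T$. Its width is $\max_{t}|X_t|-1$, and the tree-width of $G$ is the minimum width of a tree-decomposition of $G$. A graph $G$ contains a graph $H$ as a minor if a graph isomorphic to $H$ can be obtained from $G$ by a sequence of vertex deletions, edge deletions and edge contractions. An apex-forest is a graph that can be made a forest by deleting at most one vertex. **Theorem.** Let $H$ be an apex-forest. Then every graph of tree-width at least $|V(H)|-1$ contains $H$ as a minor. In other words, if $V(H)\neq\emptyset$ and $f(H)$ denotes the smallest integer such that every graph of tree-width at least $f(H)$ contains $H$ as a minor, then $f(H)=|V(H)|-1$. The lower bound $f(H)\ge |V(H)|-1$ is witnessed by the complete graph on $|V(H)|-1$ vertices, which has tree-width $|V(H)|-2$ and does not contain $H$ as a minor. (The graph without vertices is allowed here; its tree-width is $-1$.) -/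

import Mathlib

universe u v

namespace SimpleGraph

/-- A tree-decomposition of `G`: a finite tree together with a bag of vertices of `G` at each of
its nodes. -/
structure TreeDecomposition {V : Type u} (G : SimpleGraph V) where
  /-- The nodes of the tree. -/
  Node : Type u
  [fintypeNode : Fintype Node]
  /-- The tree. -/
  tree : SimpleGraph Node
  isTree : tree.IsTree
  /-- The bag at a node. -/
  bag : Node → Finset V
  exists_mem_bag : ∀ x : V, ∃ t, x ∈ bag t
  exists_adj_mem_bag : ∀ x y : V, G.Adj x y → ∃ t, x ∈ bag t ∧ y ∈ bag t
  connected_induce : ∀ x : V, (tree.induce {t | x ∈ bag t}).Connected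

attribute [instance] TreeDecomposition.fintypeNode

/-- The width of a tree-decomposition: the largest size of a bag, minus one (an integer). -/
def TreeDecomposition.width {V : Type u} {G : SimpleGraph V} (D : G.TreeDecomposition) : ℤ :=
  ((Finset.univ.sup fun t : D.Node => (D.bag t).card : ℕ) : ℤ) - 1

/-- The tree-width of a (finite) graph: the minimum width of a tree-decomposition.
It is an integer; the tree-width of the graph without vertices is `-1`. -/
noncomputable def treewidth {V : Type u} (G : SimpleGraph V) : ℤ :=
  sInf (Set.range (TreeDecomposition.width (G := G)))

/-- For a finite graph the tree-width is attained and minimal. -/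
theorem isLeast_treewidth {V : Type u} [Finite V] (G : SimpleGraph V) :
    IsLeast (Set.range (TreeDecomposition.width (G := G))) G.treewidth := by
  have := Fintype.ofFinite V
  let D : G.TreeDecomposition :=
    { Node := PUnit
      tree := ⊥
      isTree := IsTree.of_subsingleton
      bag := fun _ => Finset.univ
      exists_mem_bag := fun x => ⟨PUnit.unit, Finset.mem_univ x⟩
      exists_adj_mem_bag := fun x y _ => ⟨PUnit.unit, Finset.mem_univ x, Finset.mem_univ y⟩
      connected_induce := fun x =>
        have : Nonempty {t : PUnit | x ∈ (Finset.univ : Finset V)} :=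
          ⟨⟨PUnit.unit, Finset.mem_univ x⟩⟩
        { preconnected := Preconnected.of_subsingleton
          nonempty := this } }
  have hne : (Set.range (TreeDecomposition.width (G := G))).Nonempty := ⟨_, D, rfl⟩
  have hbdd : BddBelow (Set.range (TreeDecomposition.width (G := G))) := by
    refine ⟨-1, ?_⟩
    rintro _ ⟨D, rfl⟩
    unfold TreeDecomposition.width
    omega
  exact ⟨Int.csInf_mem hne hbdd, fun _ h => csInf_le hbdd h⟩

/-- The simple graph obtained from `G` by contracting the edge `ab`: the vertex `b` is merged
into `a`, which keeps its name, and loops and parallel edges are dropped. -/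
def contractEdge {V : Type u} (G : SimpleGraph V) (a b : V) : SimpleGraph {x : V // x ≠ b} :=
  SimpleGraph.fromRel fun x y => G.Adj x y ∨ ((x : V) = a ∧ G.Adj b y)

/-- `H.IsMinorOf G` (`G` contains `H` as a minor): a graph isomorphic to `H` can
be obtained from `G` by a (finite) sequence of vertex deletions, edge deletions and edge contractions. -/
inductive IsMinorOf {W : Type v} (H : SimpleGraph W) :
    ∀ {V : Type u}, SimpleGraph V → Prop
  | of_iso {V : Type u} {G : SimpleGraph V} (φ : G ≃g H) : IsMinorOf H G
  | of_deleteVertex {V : Type u} {G : SimpleGraph V} (a : V)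
      (h : IsMinorOf H (G.induce {x | x ≠ a})) : IsMinorOf H G
  | of_deleteEdge {V : Type u} {G : SimpleGraph V} (e : Sym2 V) (he : e ∈ G.edgeSet)
      (h : IsMinorOf H (G.deleteEdges {e})) : IsMinorOf H G
  | of_contractEdge {V : Type u} {G : SimpleGraph V} (a b : V) (hab : G.Adj a b)
      (h : IsMinorOf H (G.contractEdge a b)) : IsMinorOf H G

/-- An apex-forest: deleting at most one vertex leaves a forest. -/
def IsApexForest {W : Type v} (H : SimpleGraph W) : Prop :=
  ∃ s : Set W, s.Subsingleton ∧ (H.induce sᶜ).IsAcyclic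

/-- Every finite graph of tree-width at least `k` contains `H` as a minor. The least integer `k`
with this property is the number `f(H)`. -/
def TreewidthForcesMinor {W : Type v} (H : SimpleGraph W) (k : ℤ) : Prop :=
  ∀ (V : Type u) [Finite V] (G : SimpleGraph V), k ≤ G.treewidth → IsMinorOf H G

end SimpleGraph

/-! Put `n = |V(H)| - 1`. Two facts carry the proof. Duality (`exists_isHaven`): if no
tree-decomposition has all bags of size at most `n`, there is a family of pairwise touching sets
that contains a component of `G - S` for every `S` with at most `n` vertices. To find it, take a
maximal down-closed family `I` of vertex sets such that `G` still has no decomposition with bags of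
size at most `n` up to a private part lying in `I`. The sets outside `I` form the haven. If two of
them did not touch, minimal ones inside them could each be captured by a decomposition, by
maximality; contracting both decompositions along a Menger linkage onto a minimum separator and
gluing them there would make `I` itself sufficient (`Decomposes.of_insert_of_insert`). Growth of a
model (`IsHaven.exists_model`): a forest on at most `n` vertices is embedded one vertex at a time,
each new vertex having at most one earlier neighbour. The model stays outside a connected haven set
`C` whose neighbourhood has one vertex in each branch set and no others, and every smaller connected
haven set inside `C` has a larger neighbourhood. The new vertex starts at some `v` in `C` next to
its neighbour's branch set; the choice of `C` excludes small separations, so Menger pushes all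
branch sets on to the boundary of a smaller set `C'` (`IsHaven.exists_of_minimal`). At the end `C`
is connected, disjoint from the model and adjacent to every branch set, so it serves as the branch
set of the apex. This is why the forest needs only `|V(H)| - 1` vertices. Sharpness follows from the
Helly property of subtrees, which gives the tree-width of complete graphs. -/

namespace SimpleGraph

/-- Connectedness of a set of vertices, phrased as an induction principle: the set is non-empty,
and a set that meets it and is closed under adjacency inside it contains it. -/
def IsConn {V : Type u} (G : SimpleGraph V) (s : Set V) : Prop :=
  s.Nonempty ∧ ∀ p : Set V, (∃ x ∈ s, x ∈ p) →
    (∀ x ∈ s, ∀ y ∈ s, G.Adj x y → x ∈ p → y ∈ p) → s ⊆ p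

/-- `(P, Q)` is a separation of `G`: the two sides cover all vertices and all edges. -/
def IsSep {V : Type u} (G : SimpleGraph V) (P Q : Finset V) : Prop :=
  (∀ x, x ∈ P ∨ x ∈ Q) ∧ ∀ x y, G.Adj x y → (x ∈ P ∧ y ∈ P) ∨ (x ∈ Q ∧ y ∈ Q)

/-! ### Connected sets and separations -/

section Conn

variable {V : Type u} {G : SimpleGraph V}

theorem isConn_iff_connected_induce {s : Set V} : G.IsConn s ↔ (G.induce s).Connected := by
  constructor
  · rintro ⟨⟨x, hx⟩, h⟩
    have : Nonempty s := ⟨⟨x, hx⟩⟩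
    refine ⟨fun a b => ?_⟩
    have := h {y | ∃ hy : y ∈ s, (G.induce s).Reachable a ⟨y, hy⟩} ⟨a, a.2, a.2, Reachable.refl _⟩
      (fun x hx y hy hxy ⟨_, hr⟩ => ⟨hy, hr.trans (Adj.reachable (by simpa using hxy))⟩) b.2
    exact this.2
  · intro h
    obtain ⟨⟨x, hx⟩⟩ := h.nonempty
    refine ⟨⟨x, hx⟩, fun p ⟨a, ha, hap⟩ hcl b hb => ?_⟩
    obtain ⟨w⟩ := h.preconnected ⟨a, ha⟩ ⟨b, hb⟩
    have key : ∀ (a b : s) (_ : (G.induce s).Walk a b), (a : V) ∈ p → (b : V) ∈ p := by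
      intro a b w
      induction w with
      | nil => exact id
      | cons hadj _ ih => exact fun h' => ih (hcl _ (Subtype.coe_prop _) _ (Subtype.coe_prop _) (by simpa using hadj) h')
    exact key _ _ w hap

theorem IsConn.singleton (x : V) : G.IsConn {x} :=
  ⟨⟨x, rfl⟩, fun p ⟨y, hy, hyp⟩ _ z hz => by
    rw [Set.mem_singleton_iff] at hy hz; subst hy; subst hz; exact hyp⟩

theorem IsConn.mono_graph {G' : SimpleGraph V} {s : Set V} (h : G.IsConn s) (hle : G ≤ G') :
    G'.IsConn s :=
  ⟨h.1, fun p hp hc => h.2 p hp fun x hx y hy hxy => hc x hx y hy (hle hxy)⟩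

theorem IsConn.union_of_mem {s t : Set V} (hs : G.IsConn s) (ht : G.IsConn t) {x y : V}
    (hx : x ∈ s) (hy : y ∈ t) (hxy : x = y ∨ G.Adj x y) : G.IsConn (s ∪ t) := by
  refine ⟨⟨x, Or.inl hx⟩, fun p hp hc => ?_⟩
  have hs' : (∃ x ∈ s, x ∈ p) → s ⊆ p := fun h =>
    hs.2 p h fun x hx y hy => hc x (Or.inl hx) y (Or.inl hy)
  have ht' : (∃ x ∈ t, x ∈ p) → t ⊆ p := fun h =>
    ht.2 p h fun x hx y hy => hc x (Or.inr hx) y (Or.inr hy)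
  have h1 : x ∈ p ↔ y ∈ p := by
    rcases hxy with rfl | h
    · rfl
    · exact ⟨hc x (Or.inl hx) y (Or.inr hy) h, hc y (Or.inr hy) x (Or.inl hx) h.symm⟩
  obtain ⟨z, hz | hz, hzp⟩ := hp
  · have h2 := hs' ⟨z, hz, hzp⟩
    exact Set.union_subset h2 (ht' ⟨y, hy, h1.1 (h2 hx)⟩)
  · have h2 := ht' ⟨z, hz, hzp⟩
    exact Set.union_subset (hs' ⟨x, hx, h1.2 (h2 hy)⟩) h2

/-- A connected set that meets `p` and leaves `p` contains an edge leaving `p`. -/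
theorem IsConn.exists_adj_of_not_subset {s p : Set V} (hs : G.IsConn s) (h : ∃ x ∈ s, x ∈ p)
    (hn : ∃ x ∈ s, x ∉ p) : ∃ x ∈ s, ∃ y ∈ s, G.Adj x y ∧ x ∈ p ∧ y ∉ p := by
  by_contra! hc
  obtain ⟨x, hx, hxp⟩ := hn
  exact hxp (hs.2 p h (fun x hx y hy hxy hxp => hc x hx y hy hxy hxp) hx)

theorem IsSep.symm {P Q : Finset V} (h : G.IsSep P Q) : G.IsSep Q P :=
  ⟨fun x => (h.1 x).symm, fun x y hxy => (h.2 x y hxy).symm⟩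

/-- A connected set meeting both sides of a separation meets the separator. -/
theorem IsConn.exists_mem_separator {P Q : Finset V} {s : Set V} (hs : G.IsConn s)
    (h : G.IsSep P Q) (hP : ∃ x ∈ s, x ∈ P) (hQ : ∃ x ∈ s, x ∈ Q) : ∃ x ∈ s, x ∈ P ∧ x ∈ Q := by
  by_contra! hc
  obtain ⟨x, hx, hxQ⟩ := hQ
  obtain ⟨a, ha, b, hb, hab, haP, hbP⟩ := hs.exists_adj_of_not_subset (p := (P : Set V))
    (by simpa using hP) ⟨x, hx, fun hxP => hc x hx (by simpa using hxP) hxQ⟩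
  have h1 := hc a ha (by simpa using haP)
  have h2 : b ∉ P := by simpa using hbP
  rcases h.2 a b hab with h' | h'
  · exact h2 h'.2
  · exact h1 h'.1

/-- If a connected set meets the separator of a separation in one vertex, then its part on
either side of the separation is connected. -/
theorem IsConn.inter_side {P Q : Finset V} {s : Set V} (hs : G.IsConn s) (h : G.IsSep P Q) {z : V}
    (hz : z ∈ s) (hzP : z ∈ P) (hu : ∀ x ∈ s, x ∈ P → x ∈ Q → x = z) :
    G.IsConn (s ∩ P) := by
  refine ⟨⟨z, hz, hzP⟩, fun p ⟨x, hx, hxp⟩ hc => ?_⟩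
  -- Within `s`, the side `P` can only be left through `z`. So if `p` missed `z`, then `p ∩ P` would
  -- be closed in all of `s` and would contain `z` after all. Once `z ∈ p`, the set `p ∪ Q` is
  -- closed in `s`.
  have hzp : z ∈ p := by
    by_contra hzp
    have := hs.2 (p ∩ P) ⟨x, hx.1, hxp, hx.2⟩ (fun a ha b hb hab hap => by
      have haQ : a ∉ Q := fun haQ => hzp (hu a ha hap.2 haQ ▸ hap.1)
      have hbP : b ∈ P := by
        rcases h.2 a b hab with h' | h'
        · exact h'.2
        · exact absurd h'.1 haQ
      exact ⟨hc a ⟨ha, hap.2⟩ b ⟨hb, hbP⟩ hab hap.1, hbP⟩)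
    exact hzp (this hz).1
  have := hs.2 (p ∪ Q) ⟨z, hz, Or.inl hzp⟩ (fun a ha b hb hab hap => by
    rcases h.2 a b hab with h' | h'
    · have hap' : a ∈ p := by
        rcases hap with h1 | h1
        · exact h1
        · rw [hu a ha h'.1 h1]; exact hzp
      exact Or.inl (hc a ⟨ha, h'.1⟩ b ⟨hb, h'.2⟩ hab hap')
    · exact Or.inr h'.2)
  rintro y ⟨hy, hyP⟩
  rcases this hy with h1 | h1
  · exact h1
  · rw [hu y hy hyP h1]; exact hzp

/-- The nodes meeting a connected set, when each vertex sits at a connected set of nodes and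
adjacent vertices share a node, form a connected set. -/
theorem IsConn.biUnion {N : Type*} {T : SimpleGraph N} {s : Set V} (hs : G.IsConn s)
    (F : V → Set N) (hF : ∀ x ∈ s, T.IsConn (F x))
    (hadj : ∀ x ∈ s, ∀ y ∈ s, G.Adj x y → ∃ t, t ∈ F x ∧ t ∈ F y) :
    T.IsConn {t | ∃ x ∈ s, t ∈ F x} := by
  obtain ⟨x, hx⟩ := hs.1
  obtain ⟨t, ht⟩ := (hF x hx).1
  refine ⟨⟨t, x, hx, ht⟩, fun p ⟨t, ⟨x, hx, ht⟩, htp⟩ hc => ?_⟩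
  have hsub : ∀ x ∈ s, (∃ t ∈ F x, t ∈ p) → F x ⊆ p := fun x hx h =>
    (hF x hx).2 p h fun a ha b hb => hc a ⟨x, hx, ha⟩ b ⟨x, hx, hb⟩
  have := hs.2 {x | F x ⊆ p} ⟨x, hx, hsub x hx ⟨t, ht, htp⟩⟩ (fun a ha b hb hab hap => by
    obtain ⟨t, hta, htb⟩ := hadj a ha b hb hab
    exact hsub b hb ⟨t, htb, hap hta⟩)
  rintro t ⟨y, hy, hty⟩
  exact this hy hty

end Conn

/-! ### Menger's theorem for disjoint connected sets -/

section Menger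

/-- If at least `Z.card` disjoint sets all meet `Z`, then they cover `Z` and each of them meets it
in a single element. -/
theorem meet_unique_of_disjoint {ι V : Type*} {I : Finset ι} {Z : Finset V}
    {M : ι → Finset V} (hd : ∀ i ∈ I, ∀ j ∈ I, ∀ x, x ∈ M i → x ∈ M j → i = j)
    (hm : ∀ i ∈ I, ∃ z ∈ M i, z ∈ Z) (hc : Z.card ≤ I.card) :
    (∀ z ∈ Z, ∃ i ∈ I, z ∈ M i) ∧
      ∀ i ∈ I, ∀ z ∈ Z, ∀ w ∈ Z, z ∈ M i → w ∈ M i → z = w := by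
  classical
  choose e heM heZ using hm
  -- Choosing one element of `Z` from each set is injective by disjointness, hence a bijection onto
  -- `Z` by the cardinality bound.
  have hinj : Function.Injective fun i : I => e i.1 i.2 := fun i j hij =>
    Subtype.ext (hd i i.2 j j.2 (e i i.2) (heM i i.2) (by simp only at hij; rw [hij]; exact heM j j.2))
  have himg : I.attach.image (fun i => e i.1 i.2) = Z := by
    apply Finset.eq_of_subset_of_card_le
    · intro z hz
      obtain ⟨i, _, rfl⟩ := Finset.mem_image.1 hz
      exact heZ i.1 i.2
    · rwa [Finset.card_image_of_injective _ hinj, Finset.card_attach]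
  have hsurj : ∀ z ∈ Z, ∃ i, ∃ hi : i ∈ I, e i hi = z := by
    intro z hz
    rw [← himg] at hz
    simpa using hz
  refine ⟨fun z hz => ?_, fun i hi z hz w hw hzi hwi => ?_⟩
  · obtain ⟨i, hi, rfl⟩ := hsurj z hz
    exact ⟨i, hi, heM i hi⟩
  · obtain ⟨j, hj, rfl⟩ := hsurj z hz
    obtain ⟨l, hl, rfl⟩ := hsurj w hw
    have h1 := hd i hi j hj _ hzi (heM j hj)
    have h2 := hd i hi l hl _ hwi (heM l hl)
    subst h1; subst h2; rfl

/-- A linkage of order `k` from `A` to `B`: `k` disjoint connected sets that meet both. -/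
def HasLinkage {V : Type u} (G : SimpleGraph V) (A B : Finset V) (k : ℕ) : Prop :=
  ∃ L : Finset (Finset V), L.card = k ∧
    (∀ M ∈ L, G.IsConn M ∧ (∃ x ∈ M, x ∈ A) ∧ ∃ x ∈ M, x ∈ B) ∧
    ∀ M ∈ L, ∀ M' ∈ L, ∀ x, x ∈ M → x ∈ M' → M = M'

/-- A linkage onto a set of the same order can be indexed by that set. -/
theorem HasLinkage.exists_family {V : Type u} [Nonempty V] {G : SimpleGraph V} {A B : Finset V}
    {k : ℕ} (h : G.HasLinkage A B k) {Z : Finset V} (hZ : Z.card = k)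
    (hm : ∀ M : Finset V, G.IsConn M → (∃ x ∈ M, x ∈ A) → (∃ x ∈ M, x ∈ B) → ∃ x ∈ M, x ∈ Z) :
    ∃ M : V → Finset V, (∀ z ∈ Z, z ∈ M z ∧ G.IsConn (M z) ∧ (∃ x ∈ M z, x ∈ A) ∧
      (∃ x ∈ M z, x ∈ B) ∧ ∀ w ∈ Z, w ∈ M z → w = z) ∧
      ∀ z ∈ Z, ∀ w ∈ Z, ∀ x, x ∈ M z → x ∈ M w → z = w := by
  obtain ⟨L, hLk, hL, hd⟩ := h
  obtain ⟨h1, h2⟩ := meet_unique_of_disjoint (M := id) (I := L) (Z := Z) hd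
    (fun M hM => hm M (hL M hM).1 (hL M hM).2.1 (hL M hM).2.2) (by omega)
  choose! M hML hM using h1
  refine ⟨M, fun z hz => ⟨hM z hz, (hL _ (hML z hz)).1, (hL _ (hML z hz)).2.1,
    (hL _ (hML z hz)).2.2, fun w hw hwz => h2 _ (hML z hz) w hw z hz hwz (hM z hz)⟩,
    fun z hz w hw x hxz hxw => ?_⟩
  have := hd _ (hML z hz) _ (hML w hw) x hxz hxw
  exact h2 _ (hML z hz) z hz w hw (hM z hz) (this ▸ hM w hw)

/-- The edges of `G` inside `P`. -/
def onSet {V : Type u} (G : SimpleGraph V) (P : Finset V) : SimpleGraph V where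
  Adj x y := G.Adj x y ∧ x ∈ P ∧ y ∈ P
  symm := ⟨fun _ _ h => ⟨h.1.symm, h.2.2, h.2.1⟩⟩
  loopless := ⟨fun _ h => h.1.ne rfl⟩

theorem onSet_le {V : Type u} (G : SimpleGraph V) (P : Finset V) : G.onSet P ≤ G :=
  fun _ _ h => h.1

theorem IsConn.subset_of_onSet {V : Type u} {G : SimpleGraph V} {P : Finset V} {s : Set V}
    (hs : (G.onSet P).IsConn s) (h : ∃ x ∈ s, x ∈ P) : s ⊆ P :=
  hs.2 P h fun _ _ _ _ hxy _ => hxy.2.2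

/-- A separation of the part of `G - xy` on one side of a separation of `G - xy` gives
a separation of `G`. -/
theorem isSep_of_isSep_onSet {V : Type u} [DecidableEq V] {G : SimpleGraph V} {x y : V}
    {P Q C D : Finset V}
    (hPQ : (G.deleteEdges {s(x, y)}).IsSep P Q) (hy : y ∉ P)
    (hCD : ((G.deleteEdges {s(x, y)}).onSet P).IsSep C D) (hxD : x ∈ D) :
    G.IsSep (C ∩ P) (D ∪ Q) := by
  refine ⟨fun v => ?_, fun u v huv => ?_⟩
  · have := hPQ.1 v; have := hCD.1 v
    simp only [Finset.mem_inter, Finset.mem_union]; tauto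
  · simp only [Finset.mem_inter, Finset.mem_union]
    by_cases he : s(u, v) = s(x, y)
    -- The deleted edge lies inside `D ∪ Q`, because `x ∈ D` and `y ∈ Q`.
    · have hyQ : y ∈ Q := (hPQ.1 y).resolve_left hy
      rcases Sym2.eq_iff.1 he with ⟨rfl, rfl⟩ | ⟨rfl, rfl⟩ <;> tauto
    · have h1 : (G.deleteEdges {s(x, y)}).Adj u v := by simp [deleteEdges_adj, huv, he]
      rcases hPQ.2 u v h1 with h | h
      · rcases hCD.2 u v ⟨h1, h.1, h.2⟩ with h' | h' <;> tauto
      · tauto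

/-- **Menger's theorem**, with disjoint connected sets in place of disjoint paths: if all
separations of `A` from `B` have order at least `k`, then there is a linkage of order `k`. -/
theorem hasLinkage_of_forall_isSep {V : Type u} [Fintype V] [DecidableEq V] (G : SimpleGraph V)
    (A B : Finset V) (k : ℕ)
    (h : ∀ P Q, G.IsSep P Q → A ⊆ P → B ⊆ Q → k ≤ (P ∩ Q).card) : G.HasLinkage A B k := by
  induction G using WellFoundedLT.induction generalizing A B with
  | ind G ih =>
  by_cases hbot : ∃ x y, G.Adj x y
  swap
  · push Not at hbot
    have h1 : k ≤ (A ∩ B).card := by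
      have := h A (Finset.univ \ A ∪ B) ⟨fun x => by simp; tauto, fun x y hxy => (hbot x y hxy).elim⟩
        (by simp) (by intro x; simp; tauto)
      refine this.trans (Finset.card_le_card ?_)
      intro x; simp; tauto
    obtain ⟨I, hI, hIk⟩ := Finset.exists_subset_card_eq h1
    refine ⟨I.image fun x => {x}, ?_, ?_, ?_⟩
    · rw [Finset.card_image_of_injective _ (Finset.singleton_injective), hIk]
    · intro M hM
      obtain ⟨x, hx, rfl⟩ := Finset.mem_image.1 hM
      have := hI hx
      rw [Finset.mem_inter] at this
      exact ⟨by simpa using IsConn.singleton x, ⟨x, by simp, this.1⟩, ⟨x, by simp, this.2⟩⟩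
    · intro M hM M' hM' x hx hx'
      obtain ⟨y, hy, rfl⟩ := Finset.mem_image.1 hM
      obtain ⟨z, hz, rfl⟩ := Finset.mem_image.1 hM'
      rw [Finset.mem_singleton] at hx hx'
      rw [← hx, ← hx']
  obtain ⟨x, y, hxy⟩ := hbot
  have hlt : G.deleteEdges {s(x, y)} < G := by
    refine lt_of_le_of_ne (deleteEdges_le _) fun he => ?_
    have : (G.deleteEdges {s(x, y)}).Adj x y := by rw [he]; exact hxy
    simp [deleteEdges_adj] at this
  -- Either `xy` is dispensable, or `G - xy` has a separation of order less than `k`; the edge then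
  -- crosses it, since otherwise it would separate `G`.
  by_cases hk : ∀ P Q, (G.deleteEdges {s(x, y)}).IsSep P Q → A ⊆ P → B ⊆ Q → k ≤ (P ∩ Q).card
  · obtain ⟨L, h1, h2, h3⟩ := ih _ hlt A B hk
    exact ⟨L, h1, fun M hM => ⟨(h2 M hM).1.mono_graph hlt.le, (h2 M hM).2⟩, h3⟩
  push Not at hk
  obtain ⟨P, Q, hsep, hAP, hBQ, hlt'⟩ := hk
  wlog hxP : x ∈ P ∧ x ∉ Q ∧ y ∈ Q ∧ y ∉ P generalizing x y
  · refine this y x hxy.symm ?_ ?_ ?_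
    · rwa [Sym2.eq_swap]
    · rwa [Sym2.eq_swap]
    · by_contra hyP
      refine absurd (h P Q ⟨hsep.1, fun u v huv => ?_⟩ hAP hBQ) (by omega)
      by_cases he : s(u, v) = s(x, y)
      · have := hsep.1 x
        have := hsep.1 y
        rcases Sym2.eq_iff.1 he with ⟨rfl, rfl⟩ | ⟨rfl, rfl⟩ <;> tauto
      · exact hsep.2 u v (by simp [deleteEdges_adj, huv, he])
  obtain ⟨hxP, hxQ, hyQ, hyP⟩ := hxP
  have hsep' : (G.deleteEdges {s(y, x)}).IsSep Q P := by rw [Sym2.eq_swap]; exact hsep.symm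
  have hx1 : x ∉ P ∩ Q := by simp [hxQ]
  have hy1 : y ∉ P ∩ Q := by simp [hyP]
  -- Adding `x` to `Q` repairs the separation for `G` at the cost of one vertex, so its order is
  -- exactly `k - 1`.
  have hcard : (P ∩ Q).card + 1 = k := by
    have := h P (insert x Q) ⟨fun v => by have := hsep.1 v; simp; tauto, fun u v huv => by
      by_cases he : s(u, v) = s(x, y)
      · rcases Sym2.eq_iff.1 he with ⟨rfl, rfl⟩ | ⟨rfl, rfl⟩ <;> simp [hyQ]
      · have := hsep.2 u v (by simp [deleteEdges_adj, huv, he])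
        simp; tauto⟩ hAP (hBQ.trans (Finset.subset_insert _ _))
    have h2 : P ∩ insert x Q = insert x (P ∩ Q) := by
      rw [Finset.inter_insert_of_mem hxP]
    rw [h2, Finset.card_insert_of_notMem hx1] at this
    omega
  have hne : Nonempty V := ⟨x⟩
  -- Induction links `A` to `(P ∩ Q) + x` inside `P` and, below, `(P ∩ Q) + y` to `B` inside `Q`. A
  -- small separation on one side would extend over the other side to a small separation of `G`.
  have hG1 : ((G.deleteEdges {s(x, y)}).onSet P).HasLinkage A (insert x (P ∩ Q)) k := by
    refine ih _ ((onSet_le _ _).trans_lt hlt) _ _ fun C D hCD hAC hD => ?_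
    rw [Finset.insert_subset_iff] at hD
    have := h _ _ (isSep_of_isSep_onSet hsep hyP hCD hD.1) (Finset.subset_inter hAC hAP)
      (hBQ.trans Finset.subset_union_right)
    refine this.trans (Finset.card_le_card ?_)
    intro v hv
    have := @hD.2 v
    simp at *; tauto
  have hG2 : ((G.deleteEdges {s(x, y)}).onSet Q).HasLinkage (insert y (P ∩ Q)) B k := by
    refine ih _ ((onSet_le _ _).trans_lt hlt) _ _ fun C D hCD hC hBD => ?_
    rw [Finset.insert_subset_iff] at hC
    have := h _ _ (isSep_of_isSep_onSet hsep' hxQ (by rw [Sym2.eq_swap]; exact hCD.symm) hC.1).symm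
      (hAP.trans Finset.subset_union_right) (Finset.subset_inter hBD hBQ)
    refine this.trans (Finset.card_le_card ?_)
    intro v hv
    have := @hC.2 v
    simp at *; tauto
  obtain ⟨M₁, h₁, hd₁⟩ := hG1.exists_family (Z := insert x (P ∩ Q))
    (by rw [Finset.card_insert_of_notMem hx1, hcard]) (fun _ _ _ h => h)
  obtain ⟨M₂, h₂, hd₂⟩ := hG2.exists_family (Z := insert y (P ∩ Q))
    (by rw [Finset.card_insert_of_notMem hy1, hcard]) (fun _ _ h _ => h)
  have hM₁ : ∀ z ∈ insert x (P ∩ Q), M₁ z ⊆ P := fun z hz => by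
    obtain ⟨a, ha, haA⟩ := (h₁ z hz).2.2.1
    have := (h₁ z hz).2.1.subset_of_onSet ⟨a, by simpa using ha, hAP haA⟩
    simpa using this
  have hM₂ : ∀ z ∈ insert y (P ∩ Q), M₂ z ⊆ Q := fun z hz => by
    obtain ⟨a, ha, haB⟩ := (h₂ z hz).2.2.2.1
    have := (h₂ z hz).2.1.subset_of_onSet ⟨a, by simpa using ha, hBQ haB⟩
    simpa using this
  -- The two linkages are matched at the common vertices of `P ∩ Q`, and from `x` to `y` across the
  -- edge `xy`.
  let τ : V → V := fun z => if z = x then y else z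
  have hτ : ∀ z ∈ insert x (P ∩ Q), τ z ∈ insert y (P ∩ Q) := by
    intro z hz
    simp only [τ]
    split_ifs with h
    · simp
    · exact Finset.mem_insert_of_mem ((Finset.mem_insert.1 hz).resolve_left h)
  have hτinj : ∀ z ∈ insert x (P ∩ Q), ∀ w ∈ insert x (P ∩ Q), τ z = τ w → z = w := by
    intro z hz w hw hzw
    have h1 : ∀ z ∈ insert x (P ∩ Q), z ≠ x → z ≠ y := by
      rintro z hz h1 rfl
      exact hy1 ((Finset.mem_insert.1 hz).resolve_left h1)
    simp only [τ] at hzw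
    split_ifs at hzw with h2 h3 h3
    · rw [h2, h3]
    · exact absurd hzw.symm (h1 w hw h3)
    · exact absurd hzw (h1 z hz h2)
    · exact hzw
  have hcross : ∀ z ∈ insert x (P ∩ Q), ∀ w ∈ insert x (P ∩ Q), ∀ v, v ∈ M₁ z → v ∈ M₂ (τ w) →
      z = w := by
    intro z hz w hw v hv1 hv2
    have hv : v ∈ P ∩ Q := Finset.mem_inter.2 ⟨hM₁ z hz hv1, hM₂ _ (hτ w hw) hv2⟩
    have e1 : v = z := (h₁ z hz).2.2.2.2 v (Finset.mem_insert_of_mem hv) hv1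
    have e2 : v = τ w := (h₂ _ (hτ w hw)).2.2.2.2 v (Finset.mem_insert_of_mem hv) hv2
    apply hτinj z hz w hw
    rw [← e2, ← e1]
    simp only [τ]
    rw [if_neg]
    rintro rfl; exact hx1 hv
  have hdisj : ∀ z ∈ insert x (P ∩ Q), ∀ w ∈ insert x (P ∩ Q), ∀ v,
      v ∈ M₁ z ∪ M₂ (τ z) → v ∈ M₁ w ∪ M₂ (τ w) → z = w := by
    intro z hz w hw v hv1 hv2
    rcases Finset.mem_union.1 hv1 with hv1 | hv1 <;> rcases Finset.mem_union.1 hv2 with hv2 | hv2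
    · exact hd₁ z hz w hw v hv1 hv2
    · exact hcross z hz w hw v hv1 hv2
    · exact (hcross w hw z hz v hv2 hv1).symm
    · exact hτinj z hz w hw (hd₂ _ (hτ z hz) _ (hτ w hw) v hv1 hv2)
  refine ⟨(insert x (P ∩ Q)).image fun z => M₁ z ∪ M₂ (τ z), ?_, ?_, ?_⟩
  · rw [Finset.card_image_of_injOn, Finset.card_insert_of_notMem hx1, hcard]
    intro z hz w hw hzw
    have hzz : z ∈ M₁ z ∪ M₂ (τ z) := Finset.mem_union_left _ (h₁ z hz).1
    refine hdisj z hz w hw z hzz ?_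
    simp only at hzw
    rwa [← hzw]
  · intro M hM
    obtain ⟨z, hz, rfl⟩ := Finset.mem_image.1 hM
    obtain ⟨a, ha, haA⟩ := (h₁ z hz).2.2.1
    obtain ⟨b, hb, hbB⟩ := (h₂ _ (hτ z hz)).2.2.2.1
    refine ⟨?_, ⟨a, Finset.mem_union_left _ ha, haA⟩, ⟨b, Finset.mem_union_right _ hb, hbB⟩⟩
    rw [Finset.coe_union]
    have hle : ∀ R, (G.deleteEdges {s(x, y)}).onSet R ≤ G := fun R => (onSet_le _ R).trans hlt.le
    refine ((h₁ z hz).2.1.mono_graph (hle _)).union_of_mem ((h₂ _ (hτ z hz)).2.1.mono_graph (hle _))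
      (Finset.mem_coe.2 (h₁ z hz).1) (Finset.mem_coe.2 (h₂ _ (hτ z hz)).1) ?_
    simp only [τ]
    split_ifs with h
    · right; rw [h]; exact hxy
    · left; rfl
  · intro M hM M' hM' v hv hv'
    obtain ⟨z, hz, rfl⟩ := Finset.mem_image.1 hM
    obtain ⟨w, hw, rfl⟩ := Finset.mem_image.1 hM'
    rw [hdisj z hz w hw v hv hv']

end Menger

/-! ### Tree-width duality: gluing and contracting decompositions, and havens -/

section Duality

theorem IsConn.map {V N : Type*} {G : SimpleGraph V} {T : SimpleGraph N} {s : Set V}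
    (hs : G.IsConn s) (f : G →g T) : T.IsConn (f '' s) := by
  refine ⟨hs.1.image f, fun p ⟨_, ⟨x, hx, rfl⟩, hxp⟩ hc => ?_⟩
  have := hs.2 (f ⁻¹' p) ⟨x, hx, hxp⟩ fun a ha b hb hab =>
    hc _ ⟨a, ha, rfl⟩ _ ⟨b, hb, rfl⟩ (f.map_adj hab)
  rintro _ ⟨y, hy, rfl⟩
  exact this hy

/-- Joining two trees by an edge gives a tree. -/
theorem IsTree.sum_sup_edge {N₁ N₂ : Type*} [Finite N₁] [Finite N₂] {T₁ : SimpleGraph N₁}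
    {T₂ : SimpleGraph N₂} (h₁ : T₁.IsTree) (h₂ : T₂.IsTree) (t₁ : N₁) (t₂ : N₂) :
    ((T₁ ⊕g T₂) ⊔ edge (Sum.inl t₁) (Sum.inr t₂)).IsTree := by
  have hconn := h₁.connected.sum_sup_edge h₂.connected (v := t₁) (w := t₂)
  rw [isTree_iff_connected_and_card] at h₁ h₂ ⊢
  -- Connectedness bounds the number of edges from below; the upper bound adds the edges of both
  -- trees and the new one.
  refine ⟨hconn, le_antisymm ?_ hconn.card_vert_le_card_edgeSet_add_one⟩
  have h3 : Nat.card (T₁ ⊕g T₂).edgeSet = Nat.card T₁.edgeSet + Nat.card T₂.edgeSet := by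
    rw [Nat.card_congr edgeSetSumEquiv, Nat.card_sum]
  have h4 : Nat.card ((T₁ ⊕g T₂) ⊔ edge (Sum.inl t₁) (Sum.inr t₂)).edgeSet
      ≤ Nat.card (T₁ ⊕g T₂).edgeSet + 1 := by
    rw [Nat.card_coe_set_eq, Nat.card_coe_set_eq, edgeSet_sup]
    refine (Set.ncard_union_le _ _).trans (Nat.add_le_add_left ?_ _)
    rw [edge, edgeSet_fromEdgeSet]
    exact (Set.ncard_le_ncard Set.sdiff_subset).trans_eq (Set.ncard_singleton _)
  have h5 : Nat.card (N₁ ⊕ N₂) = Nat.card N₁ + Nat.card N₂ := Nat.card_sum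
  omega

variable {V : Type u} {G : SimpleGraph V}

/-- The tree `T` and the bags `b` form a tree-decomposition of the subgraph induced on `Q`. -/
structure IsDecOn (G : SimpleGraph V) (Q : Finset V) {N : Type u} (T : SimpleGraph N)
    (b : N → Finset V) : Prop where
  isTree : T.IsTree
  subset : ∀ t, b t ⊆ Q
  conn : ∀ x ∈ Q, T.IsConn {t | x ∈ b t}
  adj : ∀ x ∈ Q, ∀ y ∈ Q, G.Adj x y → ∃ t, x ∈ b t ∧ y ∈ b t

theorem IsDecOn.single (G : SimpleGraph V) (Q : Finset V) :
    G.IsDecOn Q (⊥ : SimpleGraph PUnit.{u + 1}) fun _ => Q where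
  isTree := IsTree.of_subsingleton
  subset _ := subset_rfl
  conn x hx := by
    convert IsConn.singleton PUnit.unit
    ext t; simpa using hx
  adj x hx y hy _ := ⟨PUnit.unit, hx, hy⟩

/-- By `hZ`, the nodes of a shared vertex on the two sides are joined through the new tree edge; by
`hE`, every edge lies in one of the two parts. -/
theorem IsDecOn.glue [DecidableEq V] {N₁ N₂ : Type u} [Finite N₁] [Finite N₂] {T₁ : SimpleGraph N₁}
    {T₂ : SimpleGraph N₂} {b₁ : N₁ → Finset V} {b₂ : N₂ → Finset V} {Q₁ Q₂ : Finset V}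
    (h₁ : G.IsDecOn Q₁ T₁ b₁) (h₂ : G.IsDecOn Q₂ T₂ b₂) {t₁ : N₁} {t₂ : N₂}
    (hZ : ∀ x ∈ Q₁, x ∈ Q₂ → x ∈ b₁ t₁ ∧ x ∈ b₂ t₂)
    (hE : ∀ x ∈ Q₁, ∀ y ∈ Q₂, G.Adj x y → x ∈ Q₂ ∨ y ∈ Q₁) :
    G.IsDecOn (Q₁ ∪ Q₂) ((T₁ ⊕g T₂) ⊔ edge (Sum.inl t₁) (Sum.inr t₂)) (Sum.elim b₁ b₂) := by
  have hl : ∀ x ∈ Q₁, ((T₁ ⊕g T₂) ⊔ edge (Sum.inl t₁) (Sum.inr t₂)).IsConn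
      (Sum.inl '' {t | x ∈ b₁ t}) := fun x hx =>
    ((h₁.conn x hx).map (Embedding.sumInl (H := T₂)).toHom).mono_graph le_sup_left
  have hr : ∀ x ∈ Q₂, ((T₁ ⊕g T₂) ⊔ edge (Sum.inl t₁) (Sum.inr t₂)).IsConn
      (Sum.inr '' {t | x ∈ b₂ t}) := fun x hx =>
    ((h₂.conn x hx).map (Embedding.sumInr (G := T₁)).toHom).mono_graph le_sup_left
  have heq : ∀ x, {t | x ∈ Sum.elim b₁ b₂ t} =
      (Sum.inl '' {t | x ∈ b₁ t} ∪ Sum.inr '' {t | x ∈ b₂ t} : Set (N₁ ⊕ N₂)) := by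
    intro x; ext t; cases t <;> simp
  have hedge : ((T₁ ⊕g T₂) ⊔ edge (Sum.inl t₁) (Sum.inr t₂)).Adj (Sum.inl t₁) (Sum.inr t₂) := by
    simp [edge_adj]
  refine ⟨h₁.isTree.sum_sup_edge h₂.isTree t₁ t₂, ?_, fun x hx => ?_, fun x hx y hy hxy => ?_⟩
  · rintro (t | t)
    · exact (h₁.subset t).trans Finset.subset_union_left
    · exact (h₂.subset t).trans Finset.subset_union_right
  · rw [heq]
    by_cases hx1 : x ∈ Q₁
    · by_cases hx2 : x ∈ Q₂
      · exact (hl x hx1).union_of_mem (hr x hx2) ⟨t₁, (hZ x hx1 hx2).1, rfl⟩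
          ⟨t₂, (hZ x hx1 hx2).2, rfl⟩ (Or.inr hedge)
      · have : {t | x ∈ b₂ t} = ∅ := Set.eq_empty_iff_forall_notMem.2 fun t ht => hx2 (h₂.subset t ht)
        rw [this, Set.image_empty, Set.union_empty]
        exact hl x hx1
    · have : {t | x ∈ b₁ t} = ∅ := Set.eq_empty_iff_forall_notMem.2 fun t ht => hx1 (h₁.subset t ht)
      rw [this, Set.image_empty, Set.empty_union]
      exact hr x ((Finset.mem_union.1 hx).resolve_left hx1)
  · have key : (x ∈ Q₁ ∧ y ∈ Q₁) ∨ (x ∈ Q₂ ∧ y ∈ Q₂) := by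
      have h3 := hE x
      have h4 := fun hy hx => hE y hy x hx hxy.symm
      rw [Finset.mem_union] at hx hy
      have h5 := fun hx hy => h3 hx y hy hxy
      tauto
    rcases key with h | h
    · obtain ⟨t, ht⟩ := h₁.adj x h.1 y h.2 hxy
      exact ⟨Sum.inl t, ht⟩
    · obtain ⟨t, ht⟩ := h₂.adj x h.1 y h.2 hxy
      exact ⟨Sum.inr t, ht⟩

/-- Up to a set `C` of vertices that occur in no other bag, the bag at `t` has size at most `n`. -/
def Captures [DecidableEq V] (n : ℕ) {N : Type u} (b : N → Finset V) (t : N) (C : Finset V) : Prop :=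
  C ⊆ b t ∧ (∀ c ∈ C, ∀ s, c ∈ b s → s = t) ∧ (b t \ C).card ≤ n

/-- `G` has a tree-decomposition all of whose bags have size at most `n` up to a member of `I`. -/
def Decomposes [Fintype V] [DecidableEq V] (G : SimpleGraph V) (n : ℕ) (I : Set (Finset V)) :
    Prop :=
  ∃ (N : Type u) (_ : Finite N) (T : SimpleGraph N) (b : N → Finset V),
    G.IsDecOn Finset.univ T b ∧ ∀ t, ∃ C ∈ I, Captures n b t C

theorem card_filter_meets_le {ι : Type*} [DecidableEq V] {Q : Finset ι} {S : Finset V}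
    {br : ι → Finset V}
    (hd : ∀ q ∈ Q, ∀ r ∈ Q, ∀ x, x ∈ br q → x ∈ br r → q = r) {X : Finset ι} (hXQ : X ⊆ Q)
    (hX : ∀ q ∈ X, ∃ x ∈ br q, x ∈ S) : X.card ≤ S.card := by
  refine Finset.card_le_card_of_forall_subsingleton (fun q x => x ∈ br q)
    (fun q hq => ?_) (fun x _ q hq r hr => ?_)
  · obtain ⟨x, hx, hxS⟩ := hX q hq
    exact ⟨x, hxS, hx⟩
  · exact hd q (hXQ hq.1) r (hXQ hr.1) x hq.2 hr.2

section Contract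

variable [Fintype V] [DecidableEq V] {N : Type u} {T : SimpleGraph N} {b : N → Finset V}
  {Q : Finset V} {br : V → Finset V}

/-- A tree-decomposition induces one of the minor with branch sets `br`. -/
theorem IsDecOn.contract (h : G.IsDecOn Finset.univ T b) (hmem : ∀ q ∈ Q, q ∈ br q)
    (hconn : ∀ q ∈ Q, G.IsConn (br q)) :
    G.IsDecOn Q T fun t => {q ∈ Q | ∃ x ∈ br q, x ∈ b t} where
  isTree := h.isTree
  subset t := Finset.filter_subset _ _
  conn q hq := by
    have := (hconn q hq).biUnion (T := T) (fun x => {t | x ∈ b t})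
      (fun x _ => h.conn x (Finset.mem_univ x))
      fun x _ y _ hxy => h.adj x (Finset.mem_univ x) y (Finset.mem_univ y) hxy
    convert this using 2
    simp [hq]
  adj x hx y hy hxy := by
    obtain ⟨t, hxt, hyt⟩ := h.adj x (Finset.mem_univ x) y (Finset.mem_univ y) hxy
    exact ⟨t, by simpa [hx] using ⟨x, hmem x hx, hxt⟩, by simpa [hy] using ⟨y, hmem y hy, hyt⟩⟩

theorem IsDecOn.mem_bag_of_adj (h : G.IsDecOn Finset.univ T b) {n : ℕ} {t : N} {C : Finset V}
    (hC : Captures n b t C) {x y : V} (hx : x ∈ C) (hxy : G.Adj x y) : y ∈ b t := by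
  obtain ⟨s, hxs, hys⟩ := h.adj x (Finset.mem_univ x) y (Finset.mem_univ y) hxy
  rwa [hC.2.1 x hx s hxs] at hys

/-- The captured set shrinks to the vertices whose branch sets lie in `C`. Every other branch set
meeting the bag uses a vertex of `b t \ C`, and disjointness turns this into the bound `n`. -/
theorem IsDecOn.captures_contract (h : G.IsDecOn Finset.univ T b) (hmem : ∀ q ∈ Q, q ∈ br q)
    (hconn : ∀ q ∈ Q, G.IsConn (br q))
    (hd : ∀ q ∈ Q, ∀ r ∈ Q, ∀ x, x ∈ br q → x ∈ br r → q = r) {n : ℕ} {t : N} {C : Finset V}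
    (hC : Captures n b t C) :
    Captures n (fun t => {q ∈ Q | ∃ x ∈ br q, x ∈ b t}) t {q ∈ Q | br q ⊆ C} := by
  refine ⟨fun q hq => ?_, fun q hq s hs => ?_, ?_⟩
  · rw [Finset.mem_filter] at hq ⊢
    exact ⟨hq.1, q, hmem q hq.1, hC.1 (hq.2 (hmem q hq.1))⟩
  · rw [Finset.mem_filter] at hq hs
    obtain ⟨x, hx, hxs⟩ := hs.2
    exact hC.2.1 x (hq.2 hx) s hxs
  · refine (card_filter_meets_le hd (S := b t \ C) (fun q hq => ?_) fun q hq => ?_).trans hC.2.2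
    · exact (Finset.mem_filter.1 (Finset.mem_sdiff.1 hq).1).1
    · simp only [Finset.mem_sdiff, Finset.mem_filter, not_and] at hq
      obtain ⟨⟨hqQ, x, hx, hxt⟩, hn⟩ := hq
      -- A connected branch set that meets `C` without lying in it leaves `C` along an edge. The
      -- outer end of that edge is in `b t`, since `t` is the only node of the inner end.
      by_cases hxC : x ∈ C
      · obtain ⟨y, hy, hyC⟩ := Finset.not_subset.1 (hn hqQ)
        obtain ⟨a, ha, c, hc, hac, haC, hcC⟩ := (hconn q hqQ).exists_adj_of_not_subset
          (p := (C : Set V)) ⟨x, hx, hxC⟩ ⟨y, hy, hyC⟩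
        exact ⟨c, hc, Finset.mem_sdiff.2 ⟨h.mem_bag_of_adj hC haC hac, hcC⟩⟩
      · exact ⟨x, hx, Finset.mem_sdiff.2 ⟨hxt, hxC⟩⟩

end Contract

open Classical in
/-- The set of neighbours of `C` outside `C`. -/
noncomputable def nbr [Fintype V] (G : SimpleGraph V) (C : Finset V) : Finset V :=
  {x | x ∉ C ∧ ∃ y ∈ C, G.Adj y x}

theorem mem_nbr [Fintype V] {C : Finset V} {x : V} :
    x ∈ G.nbr C ↔ x ∉ C ∧ ∃ y ∈ C, G.Adj y x := by
  simp [nbr]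

theorem IsConn.exists_mem_nbr [Fintype V] {s : Set V} (hs : G.IsConn s) {C : Finset V}
    (h : ∃ x ∈ s, x ∈ C) (hn : ∃ x ∈ s, x ∉ C) : ∃ x ∈ s, x ∈ G.nbr C := by
  obtain ⟨a, ha, c, hc, hac, haC, hcC⟩ := hs.exists_adj_of_not_subset (p := (C : Set V)) h hn
  exact ⟨c, hc, mem_nbr.2 ⟨hcC, a, haC, hac⟩⟩

theorem isSep_nbr [Fintype V] [DecidableEq V] (G : SimpleGraph V) (C : Finset V) :
    G.IsSep (C ∪ G.nbr C) Cᶜ := by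
  refine ⟨fun x => by simp; tauto, fun x y hxy => ?_⟩
  by_cases hx : x ∈ C <;> by_cases hy : y ∈ C
  · simp [hx, hy]
  · left; simp [hx, mem_nbr, hy]; exact ⟨x, hx, hxy⟩
  · left; simp [hx, mem_nbr, hy]; exact ⟨y, hy, hxy.symm⟩
  · simp [hx, hy]

variable [Fintype V] [DecidableEq V]

/-- Given a linkage from the neighbourhood of `A` onto the separator of `(P, Q)`, a decomposition
with a node capturing `A` induces a decomposition of the far side `Q` in which this node contains
the separator. -/
theorem exists_decOn_side {n : ℕ} {I : Set (Finset V)} (hI : ∀ C ∈ I, ∀ D ⊆ C, D ∈ I)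
    {A : Finset V} (hA : A.Nonempty)
    {N : Type u} {T : SimpleGraph N} {b : N → Finset V} (h : G.IsDecOn Finset.univ T b)
    (hb : ∀ t, ∃ C, (C ∈ I ∨ C = A) ∧ Captures n b t C) {t₀ : N} (ht₀ : Captures n b t₀ A)
    (h0 : ∅ ∈ I) {P Q : Finset V} (hPQ : G.IsSep P Q) (hAP : A ∪ G.nbr A ⊆ P) {M : V → Finset V}
    (hM : ∀ z ∈ P ∩ Q, z ∈ M z ∧ G.IsConn (M z) ∧ (∃ x ∈ M z, x ∈ G.nbr A) ∧
      ∀ w ∈ P ∩ Q, w ∈ M z → w = z)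
    (hd : ∀ z ∈ P ∩ Q, ∀ w ∈ P ∩ Q, ∀ x, x ∈ M z → x ∈ M w → z = w) :
    ∃ b' : N → Finset V, G.IsDecOn Q T b' ∧ P ∩ Q ⊆ b' t₀ ∧
      ∀ t, ∃ C ∈ I, Captures n b' t C ∧ Disjoint C P := by
  -- Contract the `P`-part of each linkage member to its separator vertex and keep the vertices
  -- outside `P` as they are.
  let br : V → Finset V := fun q => if q ∈ P then M q ∩ P else {q}
  have hmem : ∀ q ∈ Q, q ∈ br q := by
    intro q hq
    by_cases hqP : q ∈ P
    · simp [br, hqP, (hM q (Finset.mem_inter.2 ⟨hqP, hq⟩)).1]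
    · simp [br, hqP]
  have hconn : ∀ q ∈ Q, G.IsConn (br q) := by
    intro q hq
    by_cases hqP : q ∈ P
    · obtain ⟨h1, h2, -, h4⟩ := hM q (Finset.mem_inter.2 ⟨hqP, hq⟩)
      simp only [br, hqP, if_true, Finset.coe_inter]
      exact h2.inter_side hPQ h1 hqP fun x hx hxP hxQ => h4 x (Finset.mem_inter.2 ⟨hxP, hxQ⟩) hx
    · simpa [br, hqP] using IsConn.singleton q
  have hdis : ∀ q ∈ Q, ∀ r ∈ Q, ∀ x, x ∈ br q → x ∈ br r → q = r := by
    intro q hq r hr x hx hx'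
    by_cases hqP : q ∈ P <;> by_cases hrP : r ∈ P <;>
      simp only [br, hqP, hrP, if_true, if_false, Finset.mem_inter, Finset.mem_singleton] at hx hx'
    · exact hd q (Finset.mem_inter.2 ⟨hqP, hq⟩) r (Finset.mem_inter.2 ⟨hrP, hr⟩) x hx.1 hx'.1
    · exact absurd (hx' ▸ hx.2) hrP
    · exact absurd (hx ▸ hx'.2) hqP
    · exact hx.symm.trans hx'
  have hnbr : ∀ q ∈ P ∩ Q, ∃ x ∈ br q, x ∈ G.nbr A := by
    intro q hq
    obtain ⟨x, hx, hxA⟩ := (hM q hq).2.2.1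
    have := hAP (Finset.mem_union_right _ hxA)
    refine ⟨x, ?_, hxA⟩
    simp [br, (Finset.mem_inter.1 hq).1, hx, this]
  -- This frees `t₀` from needing `A`: nothing in its contracted bag is captured, so that bag has
  -- size at most `n`.
  have hnA : ∀ q ∈ Q, ¬ br q ⊆ A := by
    intro q hq hqA
    by_cases hqP : q ∈ P
    · obtain ⟨x, hx, hxA⟩ := hnbr q (Finset.mem_inter.2 ⟨hqP, hq⟩)
      exact (mem_nbr.1 hxA).1 (hqA hx)
    · exact hqP (hAP (Finset.mem_union_left _ (hqA (hmem q hq))))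
  have hZ : ∀ q ∈ P ∩ Q, ∃ x ∈ br q, x ∈ b t₀ := by
    intro q hq
    obtain ⟨x, hx, hxA⟩ := hnbr q hq
    obtain ⟨y, hy, hyx⟩ := (mem_nbr.1 hxA).2
    exact ⟨x, hx, h.mem_bag_of_adj ht₀ hy hyx⟩
  refine ⟨_, h.contract hmem hconn, fun q hq => ?_, fun t => ?_⟩
  · exact Finset.mem_filter.2 ⟨(Finset.mem_inter.1 hq).2, hZ q hq⟩
  · by_cases htt : t = t₀
    · subst htt
      have := h.captures_contract hmem hconn hdis ht₀
      rw [Finset.filter_false_of_mem hnA] at this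
      exact ⟨∅, h0, this, Finset.disjoint_empty_left _⟩
    · obtain ⟨C, hC, hCt⟩ := hb t
      have hCI : C ∈ I := by
        refine hC.resolve_right ?_
        rintro rfl
        obtain ⟨a, ha⟩ := hA
        exact htt (ht₀.2.1 a ha t (hCt.1 ha))
      refine ⟨_, hI C hCI _ fun q hq => ?_, h.captures_contract hmem hconn hdis hCt, ?_⟩
      · rw [Finset.mem_filter] at hq
        exact hq.2 (hmem q hq.1)
      -- Branch sets of separator vertices meet the bag at `t₀`, whereas vertices of `C` occur only
      -- at `t ≠ t₀`.
      · rw [Finset.disjoint_left]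
        intro q hq hqP
        rw [Finset.mem_filter] at hq
        obtain ⟨x, hx, hxt⟩ := hZ q (Finset.mem_inter.2 ⟨hqP, hq.1⟩)
        exact htt (hCt.2.1 x (hq.2 hx) t₀ hxt).symm

/-- If two sets that do not touch can both be captured, then neither needs to be. -/
theorem Decomposes.of_insert_of_insert {n : ℕ} {I : Set (Finset V)}
    (hI : ∀ C ∈ I, ∀ D ⊆ C, D ∈ I) (h0 : ∅ ∈ I) {A A' : Finset V} (hA : A ∉ I) (hA' : A' ∉ I)
    (hAA' : ∀ x ∈ A, ∀ y ∈ A', x ≠ y ∧ ¬ G.Adj x y)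
    (h : G.Decomposes n (insert A I)) (h' : G.Decomposes n (insert A' I)) : G.Decomposes n I := by
  by_contra hn
  obtain ⟨N₁, _, T₁, b₁, hT₁, hb₁⟩ := h
  obtain ⟨N₂, _, T₂, b₂, hT₂, hb₂⟩ := h'
  -- Some node must capture the added set, since otherwise the decomposition would already do for
  -- `I`.
  have ex : ∀ {A : Finset V} {N : Type u} [Finite N] {T : SimpleGraph N} {b : N → Finset V},
      G.IsDecOn Finset.univ T b → (∀ t, ∃ C ∈ insert A I, Captures n b t C) →
      ∃ t, Captures n b t A := by
    intro A N _ T b hT hb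
    by_contra! hc
    refine hn ⟨N, inferInstance, T, b, hT, fun t => ?_⟩
    obtain ⟨C, hC | hC, hCt⟩ := hb t
    · subst hC; exact absurd hCt (hc t)
    · exact ⟨C, hC, hCt⟩
  obtain ⟨t₁, ht₁⟩ := ex hT₁ hb₁
  obtain ⟨t₂, ht₂⟩ := ex hT₂ hb₂
  have hne : A.Nonempty := Finset.nonempty_iff_ne_empty.2 fun h => hA (h ▸ h0)
  have hne' : A'.Nonempty := Finset.nonempty_iff_ne_empty.2 fun h => hA' (h ▸ h0)
  have hNV : Nonempty V := ⟨hne.choose⟩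
  -- The sides contain the closed neighbourhoods so that linkage members reach `G.nbr A` and `G.nbr
  -- A'`. Not touching makes `(A ∪ G.nbr A, Aᶜ)` such a separation.
  let 𝒮 : Set (Finset V × Finset V) :=
    {R | G.IsSep R.1 R.2 ∧ A ∪ G.nbr A ⊆ R.1 ∧ A' ∪ G.nbr A' ⊆ R.2}
  have h𝒮 : 𝒮.Nonempty := by
    refine ⟨(A ∪ G.nbr A, Aᶜ), ?_⟩
    refine ⟨isSep_nbr G A, subset_rfl, fun x hx => ?_⟩
    rw [Finset.mem_compl]
    intro hxA
    rcases Finset.mem_union.1 hx with h | h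
    · exact (hAA' x hxA x h).1 rfl
    · obtain ⟨y, hy, hyx⟩ := (mem_nbr.1 h).2
      exact (hAA' x hxA y hy).2 hyx.symm
  obtain ⟨⟨P, Q⟩, hPQ𝒮, hmin⟩ := 𝒮.exists_min_image
    (fun R => (R.1 ∩ R.2).card) (Set.toFinite _) h𝒮
  obtain ⟨hPQ, hAP, hAQ⟩ := hPQ𝒮
  simp only at hPQ hAP hAQ
  have hlink := hasLinkage_of_forall_isSep G (A ∪ G.nbr A) (A' ∪ G.nbr A') (P ∩ Q).card
    fun P' Q' h1 h2 h3 => hmin (P', Q') ⟨h1, h2, h3⟩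
  obtain ⟨M, hM, hd⟩ := hlink.exists_family (Z := P ∩ Q) rfl (by
    rintro M hM ⟨x, hx, hxA⟩ ⟨y, hy, hyA⟩
    obtain ⟨z, hz, hzP, hzQ⟩ := hM.exists_mem_separator hPQ ⟨x, hx, hAP hxA⟩ ⟨y, hy, hAQ hyA⟩
    exact ⟨z, hz, Finset.mem_inter.2 ⟨hzP, hzQ⟩⟩)
  have hnb : ∀ {A A' M : Finset V}, (∀ x ∈ A, ∀ y ∈ A', x ≠ y ∧ ¬ G.Adj x y) → G.IsConn M →
      (∃ x ∈ M, x ∈ A ∪ G.nbr A) → (∃ x ∈ M, x ∈ A' ∪ G.nbr A') → ∃ x ∈ M, x ∈ G.nbr A := by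
    rintro A A' M hAA' hM ⟨x, hx, hxA⟩ ⟨y, hy, hyA⟩
    rcases Finset.mem_union.1 hxA with h | h
    · refine hM.exists_mem_nbr ⟨x, hx, h⟩ ⟨y, hy, fun hyA' => ?_⟩
      rcases Finset.mem_union.1 hyA with h | h
      · exact (hAA' y hyA' y h).1 rfl
      · obtain ⟨w, hw, hwy⟩ := (mem_nbr.1 h).2
        exact (hAA' y hyA' w hw).2 hwy.symm
    · exact ⟨x, hx, h⟩
  obtain ⟨c₁, hc₁, hZ₁, hcap₁⟩ := exists_decOn_side hI hne hT₁
    (fun t => by obtain ⟨C, hC, h⟩ := hb₁ t; exact ⟨C, hC.symm, h⟩) ht₁ h0 hPQ hAP (M := M)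
    (fun z hz => ⟨(hM z hz).1, (hM z hz).2.1,
      hnb hAA' (hM z hz).2.1 (hM z hz).2.2.1 (hM z hz).2.2.2.1, (hM z hz).2.2.2.2⟩) hd
  rw [Finset.inter_comm] at hM hd
  obtain ⟨c₂, hc₂, hZ₂, hcap₂⟩ := exists_decOn_side hI hne' hT₂
    (fun t => by obtain ⟨C, hC, h⟩ := hb₂ t; exact ⟨C, hC.symm, h⟩) ht₂ h0 hPQ.symm hAQ (M := M)
    (fun z hz => ⟨(hM z hz).1, (hM z hz).2.1,
      hnb (fun x hx y hy => ⟨(hAA' y hy x hx).1.symm, fun h => (hAA' y hy x hx).2 h.symm⟩)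
        (hM z hz).2.1 (hM z hz).2.2.2.1 (hM z hz).2.2.1, (hM z hz).2.2.2.2⟩) hd
  have huniv : Q ∪ P = Finset.univ := by
    ext x; simpa using (hPQ.1 x).symm
  have hglue := hc₁.glue hc₂ (t₁ := t₁) (t₂ := t₂)
    (fun x hx hx' => ⟨hZ₁ (Finset.mem_inter.2 ⟨hx', hx⟩), hZ₂ (Finset.mem_inter.2 ⟨hx, hx'⟩)⟩)
    (fun x hx y hy hxy => by have := hPQ.2 x y hxy; tauto)
  rw [huniv] at hglue
  -- Each captured set avoids the part decomposed by the other tree, so its vertices remain private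
  -- to their node after gluing.
  refine hn ⟨N₁ ⊕ N₂, inferInstance, _, _, hglue, ?_⟩
  rintro (t | t)
  · obtain ⟨C, hC, hcap, hdisj⟩ := hcap₁ t
    refine ⟨C, hC, hcap.1, ?_, hcap.2.2⟩
    rintro x hx (s | s) hs
    · rw [hcap.2.1 x hx s hs]
    · exact absurd (hc₂.subset s hs) (Finset.disjoint_left.1 hdisj hx)
  · obtain ⟨C, hC, hcap, hdisj⟩ := hcap₂ t
    refine ⟨C, hC, hcap.1, ?_, hcap.2.2⟩
    rintro x hx (s | s) hs
    · exact absurd (hc₁.subset s hs) (Finset.disjoint_left.1 hdisj hx)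
    · rw [hcap.2.1 x hx s hs]

/-- A haven of order `n + 1`: a family of pairwise touching sets which for every set `S` of at most
`n` vertices contains a connected component of `G - S`. -/
structure IsHaven (G : SimpleGraph V) (n : ℕ) (B : Set (Finset V)) : Prop where
  touch : ∀ C ∈ B, ∀ D ∈ B, ∃ x ∈ C, ∃ y ∈ D, x = y ∨ G.Adj x y
  exists_component : ∀ S : Finset V, S.card ≤ n →
    ∃ C ∈ B, G.IsConn C ∧ Disjoint C S ∧ G.nbr C ⊆ S

/-- If removing `S` leaves three sets in `I` with no edges between them, then
the star with leaves at these sets is a decomposition. -/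
theorem decomposes_of_partition {n : ℕ} {I : Set (Finset V)} {S C₁ C₂ R : Finset V}
    (hS : S.card ≤ n) (h₁ : C₁ ∈ I) (h₂ : C₂ ∈ I) (h₃ : R ∈ I)
    (hcov : ∀ x, x ∈ S ∨ x ∈ C₁ ∨ x ∈ C₂ ∨ x ∈ R)
    (d₁ : Disjoint S C₁) (d₂ : Disjoint S C₂) (d₃ : Disjoint S R)
    (h₁₂ : ∀ x ∈ C₁, ∀ y ∈ C₂, x ≠ y ∧ ¬ G.Adj x y) (h₁₃ : ∀ x ∈ C₁, ∀ y ∈ R, x ≠ y ∧ ¬ G.Adj x y)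
    (h₂₃ : ∀ x ∈ C₂, ∀ y ∈ R, x ≠ y ∧ ¬ G.Adj x y) : G.Decomposes n I := by
  have g₁ := (IsDecOn.single G (S ∪ C₁)).glue (IsDecOn.single G (S ∪ C₂))
    (t₁ := PUnit.unit) (t₂ := PUnit.unit) (fun x hx hx' => ⟨hx, hx'⟩) (by
      intro x hx y hy hxy
      have := fun a b => (h₁₂ x a y b).2
      simp only [Finset.mem_union] at *; tauto)
  -- The tree has three nodes with the bag `S ∪ C₁` at the centre. The shape is immaterial, since
  -- any two of the bags meet exactly in `S`.
  have g₂ := g₁.glue (IsDecOn.single G (S ∪ R))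
    (t₁ := Sum.inl PUnit.unit) (t₂ := PUnit.unit) (by
      intro x hx hx'
      have h3 := fun a b => (h₁₃ x a x b).1
      have h4 := fun a b => (h₂₃ x a x b).1
      simp only [Finset.mem_union, Sum.elim_inl] at *; tauto) (by
      intro x hx y hy hxy
      have h3 := fun a b => (h₁₃ x a y b).2
      have h4 := fun a b => (h₂₃ x a y b).2
      simp only [Finset.mem_union] at *; tauto)
  have hu : S ∪ C₁ ∪ (S ∪ C₂) ∪ (S ∪ R) = Finset.univ := by
    ext x; have := hcov x; simp only [Finset.mem_union, Finset.mem_univ]; tauto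
  rw [hu] at g₂
  have hs : ∀ X : Finset V, Disjoint S X → ((S ∪ X) \ X).card ≤ n := fun X hX =>
    (Finset.card_le_card (by intro x; simp only [Finset.mem_union, Finset.mem_sdiff]; tauto)).trans hS
  have key : ∀ X Y : Finset V, Disjoint S X → (∀ x ∈ X, ∀ y ∈ Y, x ≠ y ∧ ¬ G.Adj x y) →
      ∀ c ∈ X, c ∉ S ∪ Y := by
    intro X Y hX hXY c hc hc'
    rcases Finset.mem_union.1 hc' with h | h
    · exact Finset.disjoint_left.1 hX h hc
    · exact (hXY c hc c h).1 rfl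
  have sw : ∀ {X Y : Finset V}, (∀ x ∈ X, ∀ y ∈ Y, x ≠ y ∧ ¬ G.Adj x y) →
      (∀ x ∈ Y, ∀ y ∈ X, x ≠ y ∧ ¬ G.Adj x y) := fun h x hx y hy =>
    ⟨(h y hy x hx).1.symm, fun h' => (h y hy x hx).2 h'.symm⟩
  refine ⟨_, inferInstance, _, _, g₂, ?_⟩
  rintro ((⟨⟩ | ⟨⟩) | ⟨⟩)
  · refine ⟨C₁, h₁, Finset.subset_union_right, ?_, hs _ d₁⟩
    rintro c hc ((⟨⟩ | ⟨⟩) | ⟨⟩) hcs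
    · rfl
    · exact absurd hcs (key _ _ d₁ h₁₂ c hc)
    · exact absurd hcs (key _ _ d₁ h₁₃ c hc)
  · refine ⟨C₂, h₂, Finset.subset_union_right, ?_, hs _ d₂⟩
    rintro c hc ((⟨⟩ | ⟨⟩) | ⟨⟩) hcs
    · exact absurd hcs (key _ _ d₂ (sw h₁₂) c hc)
    · rfl
    · exact absurd hcs (key _ _ d₂ h₂₃ c hc)
  · refine ⟨R, h₃, Finset.subset_union_right, ?_, hs _ d₃⟩
    rintro c hc ((⟨⟩ | ⟨⟩) | ⟨⟩) hcs
    · exact absurd hcs (key _ _ d₃ (sw h₁₃) c hc)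
    · exact absurd hcs (key _ _ d₃ (sw h₂₃) c hc)
    · rfl

/-- **Tree-width duality** (the hard direction): a graph with no tree-decomposition into bags of
size at most `n` has a haven of order `n + 1`. -/
theorem exists_isHaven {n : ℕ} (h : ¬ G.Decomposes n {∅}) : ∃ B, G.IsHaven n B := by
  obtain ⟨I, -, ⟨hI, h0, hID⟩, hmax⟩ := (Set.toFinite {I : Set (Finset V) |
    (∀ C ∈ I, ∀ D ⊆ C, D ∈ I) ∧ ∅ ∈ I ∧ ¬ G.Decomposes n I}).exists_le_maximal
    (a := {∅}) ⟨by simp, rfl, h⟩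
  -- Adding a minimal non-member keeps the family down-closed, so maximality of `I` must fail at
  -- decomposability.
  have hins : ∀ A, A ∉ I → (∀ D, D < A → D ∈ I) → G.Decomposes n (insert A I) := by
    intro A hA hmin
    by_contra hn
    refine hA (hmax (y := insert A I) ⟨?_, Or.inr h0, hn⟩ (Set.subset_insert A I)
      (Set.mem_insert A I))
    rintro C (rfl | hC) D hD
    · rcases hD.eq_or_lt with h | h
      · exact Or.inl h
      · exact Or.inr (hmin D h)
    · exact Or.inr (hI C hC D hD)
  have htouch : ∀ C ∉ I, ∀ D ∉ I, ∃ x ∈ C, ∃ y ∈ D, x = y ∨ G.Adj x y := by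
    intro C hC D hD
    by_contra! hc
    obtain ⟨A, hAC, hA, hAmin⟩ := exists_minimal_le_of_wellFoundedLT (fun X : Finset V => X ∉ I) C hC
    obtain ⟨A', hAD, hA', hAmin'⟩ :=
      exists_minimal_le_of_wellFoundedLT (fun X : Finset V => X ∉ I) D hD
    refine hID (Decomposes.of_insert_of_insert hI h0 hA hA'
      (fun x hx y hy => hc x (hAC hx) y (hAD hy)) (hins A hA fun X hX => ?_)
      (hins A' hA' fun X hX => ?_))
    · by_contra hXI
      exact hX.not_ge (hAmin hXI hX.le)
    · by_contra hXI
      exact hX.not_ge (hAmin' hXI hX.le)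
  refine ⟨Iᶜ, htouch, fun S hS => ?_⟩
  have htop : Sᶜ ∉ I := fun hSI => hID (decomposes_of_partition (R := ∅) (C₂ := ∅) hS hSI h0 h0
    (fun x => by simp; tauto) disjoint_compl_right (by simp) (by simp) (by simp) (by simp) (by simp))
  -- `C` is a minimal non-member among the unions of components of `G - S`. If it were disconnected,
  -- both pieces would be in `I` by minimality, and the remainder would be in `I` because it does
  -- not touch `C`; the three sets would then decompose `G`.
  obtain ⟨C, -, ⟨hC, hCS, hCN⟩, hmin⟩ := exists_minimal_le_of_wellFoundedLT
    (fun X : Finset V => X ∉ I ∧ Disjoint X S ∧ G.nbr X ⊆ S) Sᶜ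
    ⟨htop, disjoint_compl_left, fun x hx => by simpa using (mem_nbr.1 hx).1⟩
  have hCne : C.Nonempty := Finset.nonempty_iff_ne_empty.2 fun h => hC (h ▸ h0)
  refine ⟨C, hC, ⟨by simpa using hCne, fun p hp hcl => ?_⟩, hCS, hCN⟩
  classical
  by_contra hsub
  obtain ⟨y, hyC, hyp⟩ := Set.not_subset.1 hsub
  obtain ⟨x, hxC, hxp⟩ := hp
  have hC₁₂ : ∀ a ∈ C.filter (· ∈ p), ∀ b ∈ C.filter (· ∉ p), a ≠ b ∧ ¬ G.Adj a b := by
    intro a ha b hb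
    rw [Finset.mem_filter] at ha hb
    refine ⟨fun h => hb.2 (h ▸ ha.2), fun h => hb.2 (hcl a ha.1 b hb.1 h ha.2)⟩
  -- A proper part of `C` with no edge to the rest of `C` has its neighbours in `S`, so it is a
  -- smaller candidate.
  have hpart : ∀ X ⊆ C, X ≠ C → (∀ a ∈ X, ∀ b ∈ C, G.Adj a b → b ∈ X) → X ∈ I := by
    intro X hXC hne hX
    by_contra hXI
    refine hne (hXC.antisymm (hmin ⟨hXI, hCS.mono_left hXC, fun b hb => ?_⟩ hXC))
    obtain ⟨hbX, a, ha, hab⟩ := mem_nbr.1 hb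
    exact hCN (mem_nbr.2 ⟨fun hbC => hbX (hX a ha b hbC hab), a, hXC ha, hab⟩)
  have h₁ : C.filter (· ∈ p) ∈ I := by
    refine hpart _ (Finset.filter_subset _ _) (fun h => ?_) fun a ha b hb hab => ?_
    · exact hyp (Finset.mem_filter.1 (h.symm.subset hyC)).2
    · by_contra hbn
      exact (hC₁₂ a ha b (by simp at hbn ⊢; tauto)).2 hab
  have h₂ : C.filter (· ∉ p) ∈ I := by
    refine hpart _ (Finset.filter_subset _ _) (fun h => ?_) fun a ha b hb hab => ?_
    · exact (Finset.mem_filter.1 (h.symm.subset hxC)).2 hxp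
    · by_contra hbn
      exact (hC₁₂ b (by simp at hbn ⊢; tauto) a ha).2 hab.symm
  have hCR : ∀ a ∈ C, ∀ b ∈ (S ∪ C)ᶜ, a ≠ b ∧ ¬ G.Adj a b := by
    intro a ha b hb
    simp only [Finset.mem_compl, Finset.mem_union, not_or] at hb
    exact ⟨fun h => hb.2 (h ▸ ha), fun h => hb.1 (hCN (mem_nbr.2 ⟨hb.2, a, ha, h⟩))⟩
  have h₃ : (S ∪ C)ᶜ ∈ I := by
    by_contra hR
    obtain ⟨a, ha, b, hb, hab⟩ := htouch C hC _ hR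
    have := hCR a ha b hb
    tauto
  refine hID (decomposes_of_partition hS h₁ h₂ h₃ (fun x => ?_)
    (hCS.symm.mono_right (Finset.filter_subset _ _)) (hCS.symm.mono_right (Finset.filter_subset _ _))
    ?_ hC₁₂ (fun a ha => hCR a (Finset.filter_subset _ _ ha))
    (fun a ha => hCR a (Finset.filter_subset _ _ ha)))
  · simp only [Finset.mem_filter, Finset.mem_compl, Finset.mem_union]; tauto
  · rw [Finset.disjoint_left]; intro x; simp; tauto

theorem treewidth_lt_of_decomposes {n : ℕ} (h : G.Decomposes n {∅}) : G.treewidth < n := by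
  obtain ⟨N, _, T, b, hT, hb⟩ := h
  have := Fintype.ofFinite N
  let D : G.TreeDecomposition :=
    { Node := N
      tree := T
      isTree := hT.isTree
      bag := b
      exists_mem_bag := fun x => (hT.conn x (Finset.mem_univ x)).1
      exists_adj_mem_bag := fun x y => hT.adj x (Finset.mem_univ x) y (Finset.mem_univ y)
      connected_induce := fun x => isConn_iff_connected_induce.1 (hT.conn x (Finset.mem_univ x)) }
  have h1 : G.treewidth ≤ D.width := (isLeast_treewidth G).2 ⟨D, rfl⟩
  have h2 : (Finset.univ.sup fun t : D.Node => (D.bag t).card) ≤ n := by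
    refine Finset.sup_le fun t _ => ?_
    obtain ⟨C, hC, hCt⟩ := hb t
    have := hCt.2.2
    rw [Set.mem_singleton_iff.1 hC, Finset.sdiff_empty] at this
    exact this
  have h3 : D.width = ((Finset.univ.sup fun t : D.Node => (D.bag t).card : ℕ) : ℤ) - 1 := rfl
  omega

end Duality

/-! ### Growing a forest model against a haven -/

section Model

variable {V : Type u} {G : SimpleGraph V} [Fintype V] [DecidableEq V]

/-- The inductive step of the construction: the sets `M s` carry the old boundary together with `v`
to the boundary of a smaller set `C'` that has the same minimality property as `C`. They meet the
old model only in the old boundary, because they stay in `C ∪ G.nbr C`. -/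
theorem IsHaven.exists_of_minimal {n : ℕ} {B : Set (Finset V)} (hB : G.IsHaven n B)
    {C : Finset V} (hCB : C ∈ B)
    (hCmin : ∀ D ∈ B, G.IsConn D → D ⊂ C → (G.nbr C).card < (G.nbr D).card)
    (hn : (G.nbr C).card + 1 ≤ n) {v : V} (hv : v ∈ C) :
    ∃ C' ∈ B, G.IsConn C' ∧ C' ⊆ C ∧ (G.nbr C').card = (G.nbr C).card + 1 ∧
      (∀ D ∈ B, G.IsConn D → D ⊂ C' → (G.nbr C').card < (G.nbr D).card) ∧
      ∃ M : V → Finset V, (∀ s ∈ insert v (G.nbr C), s ∈ M s ∧ G.IsConn (M s) ∧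
        M s ⊆ C ∪ G.nbr C ∧ Disjoint (M s) C' ∧ (∃ x ∈ M s, x ∈ G.nbr C') ∧
        ∀ t ∈ insert v (G.nbr C), t ∈ M s → t = s) ∧
        ∀ s ∈ insert v (G.nbr C), ∀ t ∈ insert v (G.nbr C), ∀ x, x ∈ M s → x ∈ M t → s = t := by
  have hNV : Nonempty V := ⟨v⟩
  have hvN : v ∉ G.nbr C := fun h => (mem_nbr.1 h).1 hv
  have hcard : (insert v (G.nbr C)).card = (G.nbr C).card + 1 := Finset.card_insert_of_notMem hvN
  obtain ⟨C₁, hC₁B, hC₁c, hC₁d, hC₁N⟩ := hB.exists_component (insert v (G.nbr C)) (by omega)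
  -- `C₁` touches `C` and avoids the neighbours of `C`, so it meets `C` and cannot leave it.
  have hC₁C : C₁ ⊆ C := by
    obtain ⟨x, hx, y, hy, hxy⟩ := hB.touch C hCB C₁ hC₁B
    have hyC : y ∈ C := by
      rcases hxy with rfl | hxy
      · exact hx
      · by_contra hyC
        exact Finset.disjoint_left.1 hC₁d hy (Finset.mem_insert_of_mem (mem_nbr.2 ⟨hyC, x, hx, hxy⟩))
    intro z hz
    by_contra hzC
    obtain ⟨a, ha, haC⟩ := hC₁c.exists_mem_nbr (C := C) ⟨y, hy, hyC⟩ ⟨z, hz, hzC⟩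
    exact Finset.disjoint_left.1 hC₁d ha (Finset.mem_insert_of_mem haC)
  have hvC₁ : v ∉ C₁ := fun h => Finset.disjoint_left.1 hC₁d h (Finset.mem_insert_self _ _)
  have hss : ∀ D ⊆ C₁, D ⊂ C := fun D hD =>
    ⟨hD.trans hC₁C, fun h => hvC₁ (hD (h hv))⟩
  -- `C₁` misses `v`, so it is properly inside `C` and has more neighbours than `C`; this leaves no
  -- room for a proper subset.
  have hC₁N' : G.nbr C₁ = insert v (G.nbr C) := by
    refine Finset.eq_of_subset_of_card_le hC₁N ?_
    have := hCmin C₁ hC₁B hC₁c (hss C₁ subset_rfl)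
    omega
  -- Passing to a minimal set restores, at the new order, the minimality property needed for the
  -- next step.
  obtain ⟨C₂, hC₂C₁, ⟨hC₂B, hC₂c, hC₂N⟩, hmin⟩ := exists_minimal_le_of_wellFoundedLT
    (fun X : Finset V => X ∈ B ∧ G.IsConn X ∧ (G.nbr X).card ≤ (G.nbr C).card + 1) C₁
    ⟨hC₁B, hC₁c, by rw [hC₁N', hcard]⟩
  have hC₂N' : (G.nbr C₂).card = (G.nbr C).card + 1 := by
    have := hCmin C₂ hC₂B hC₂c (hss C₂ hC₂C₁)
    omega
  have hsep₁ : G.IsSep C₁ᶜ (C₁ ∪ insert v (G.nbr C)) := hC₁N' ▸ (isSep_nbr G C₁).symm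
  have hsep₂ : G.IsSep C₂ᶜ (C₂ ∪ G.nbr C₂) := (isSep_nbr G C₂).symm
  have hlink : G.HasLinkage C₁ᶜ (C₂ ∪ G.nbr C₂) ((G.nbr C).card + 1) := by
    -- If `P ∩ Q` is too small, the haven has a component `D` avoiding it. As `D` touches `C₂`, it
    -- lies beyond `P`, hence inside `C₁`, and has at most `(G.nbr C).card` neighbours, contrary to
    -- the choice of `C`.
    refine hasLinkage_of_forall_isSep _ _ _ _ fun P Q hPQ hP hQ => ?_
    by_contra hlt
    obtain ⟨D, hDB, hDc, hDd, hDN⟩ := hB.exists_component (P ∩ Q) (by omega)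
    have hDP : Disjoint D P := by
      rw [Finset.disjoint_left]
      intro x hxD hxP
      obtain ⟨a, ha, b, hb, hab⟩ := hB.touch C₂ hC₂B D hDB
      have hbQ : b ∈ Q := by
        apply hQ
        by_cases hbC : b ∈ C₂
        · exact Finset.mem_union_left _ hbC
        · refine Finset.mem_union_right _ (mem_nbr.2 ⟨hbC, a, ha, ?_⟩)
          exact hab.resolve_left fun h => hbC (h ▸ ha)
      obtain ⟨z, hz, hzP, hzQ⟩ := hDc.exists_mem_separator hPQ ⟨x, hxD, hxP⟩ ⟨b, hb, hbQ⟩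
      exact Finset.disjoint_left.1 hDd hz (Finset.mem_inter.2 ⟨hzP, hzQ⟩)
    have hDC₁ : D ⊆ C₁ := by
      intro x hx
      by_contra hxC
      exact Finset.disjoint_left.1 hDP hx (hP (Finset.mem_compl.2 hxC))
    have := hCmin D hDB hDc (hss D hDC₁)
    have := Finset.card_le_card hDN
    omega
  have hQsub : C₂ ∪ G.nbr C₂ ⊆ C₁ ∪ insert v (G.nbr C) := by
    intro x hx
    rcases Finset.mem_union.1 hx with h | h
    · exact Finset.mem_union_left _ (hC₂C₁ h)
    · obtain ⟨-, y, hy, hyx⟩ := mem_nbr.1 h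
      by_cases hxC : x ∈ C₁
      · exact Finset.mem_union_left _ hxC
      · exact Finset.mem_union_right _ (hC₁N' ▸ mem_nbr.2 ⟨hxC, y, hC₂C₁ hy, hyx⟩)
  have hmeet₁ : ∀ M : Finset V, G.IsConn M → (∃ x ∈ M, x ∈ C₁ᶜ) → (∃ x ∈ M, x ∈ C₂ ∪ G.nbr C₂) →
      ∃ x ∈ M, x ∈ insert v (G.nbr C) := by
    rintro M hM h1 ⟨y, hy, hyQ⟩
    obtain ⟨z, hz, hzP, hzQ⟩ := hM.exists_mem_separator hsep₁ h1 ⟨y, hy, hQsub hyQ⟩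
    exact ⟨z, hz, (Finset.mem_union.1 hzQ).resolve_left (Finset.mem_compl.1 hzP)⟩
  obtain ⟨M, hM, hMd⟩ := hlink.exists_family hcard hmeet₁
  have hmeet₂ : ∀ s ∈ insert v (G.nbr C), ∃ x ∈ M s, x ∈ G.nbr C₂ := by
    intro s hs
    obtain ⟨-, h2, ⟨x, hx, hxC⟩, h4, -⟩ := hM s hs
    obtain ⟨z, hz, hzP, hzQ⟩ := h2.exists_mem_separator hsep₂
      ⟨x, hx, Finset.mem_compl.2 fun h => Finset.mem_compl.1 hxC (hC₂C₁ h)⟩ h4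
    exact ⟨z, hz, (Finset.mem_union.1 hzQ).resolve_left (Finset.mem_compl.1 hzP)⟩
  have huniq := (meet_unique_of_disjoint (I := insert v (G.nbr C)) (M := M) hMd hmeet₂ (by omega)).2
  have hconn₁ : ∀ s ∈ insert v (G.nbr C),
      G.IsConn ((M s ∩ (C₁ ∪ insert v (G.nbr C)) : Finset V) : Set V) := by
    intro s hs
    obtain ⟨h1, h2, -, -, h5⟩ := hM s hs
    rw [Finset.coe_inter]
    refine h2.inter_side hsep₁.symm h1 (Finset.mem_union_right _ hs) fun x hx hxQ hxP => ?_
    exact h5 x ((Finset.mem_union.1 hxQ).resolve_left (Finset.mem_compl.1 hxP)) hx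
  -- Each linkage member is trimmed to the region between the two boundaries. It meets each of them
  -- exactly once, so both cuts preserve connectedness.
  refine ⟨C₂, hC₂B, hC₂c, hC₂C₁.trans hC₁C, hC₂N', fun D hDB hDc hD => ?_,
    fun s => M s ∩ (C₁ ∪ insert v (G.nbr C)) ∩ C₂ᶜ, fun s hs => ?_, fun s hs t ht x hxs hxt => ?_⟩
  · by_contra hlt
    exact hD.not_ge (hmin ⟨hDB, hDc, by omega⟩ hD.le)
  · obtain ⟨h1, h2, -, -, h5⟩ := hM s hs
    obtain ⟨x, hx, hxN⟩ := hmeet₂ s hs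
    have hxQ := hQsub (Finset.mem_union_right _ hxN)
    have hxC := (mem_nbr.1 hxN).1
    refine ⟨?_, ?_, ?_, ?_, ⟨x, ?_, hxN⟩, fun t ht hts => ?_⟩
    · simp only [Finset.mem_inter, Finset.mem_compl, Finset.mem_union]
      exact ⟨⟨h1, Or.inr hs⟩, fun h => Finset.disjoint_left.1 hC₁d (hC₂C₁ h) hs⟩
    · rw [Finset.coe_inter]
      refine (hconn₁ s hs).inter_side hsep₂ (z := x) (Finset.mem_coe.2 (Finset.mem_inter.2 ⟨hx, hxQ⟩))
        (Finset.mem_compl.2 hxC) fun y hy hyP hyQ => ?_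
      exact huniq s hs y ((Finset.mem_union.1 hyQ).resolve_left (Finset.mem_compl.1 hyP)) x hxN
        (Finset.mem_inter.1 hy).1 hx
    · intro y hy
      simp only [Finset.mem_inter, Finset.mem_union, Finset.mem_insert] at hy ⊢
      rcases hy.1.2 with h | rfl | h
      · exact Or.inl (hC₁C h)
      · exact Or.inl hv
      · exact Or.inr h
    · rw [Finset.disjoint_left]
      intro y hy
      exact Finset.mem_compl.1 (Finset.mem_inter.1 hy).2
    · simp only [Finset.mem_inter, Finset.mem_compl]
      exact ⟨⟨hx, hxQ⟩, hxC⟩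
    · exact h5 t ht (Finset.mem_inter.1 (Finset.mem_inter.1 hts).1).1
  · exact hMd s hs t ht x (Finset.mem_inter.1 (Finset.mem_inter.1 hxs).1).1
      (Finset.mem_inter.1 (Finset.mem_inter.1 hxt).1).1

/-- Every non-empty finite set of vertices of a forest contains a vertex with at most one
neighbour in the set. -/
theorem exists_at_most_one_adj {W : Type v} {H : SimpleGraph W} {s : Set W}
    (hH : (H.induce s).IsAcyclic) {U : Finset W} (hU : (U : Set W) ⊆ s) (hne : U.Nonempty) :
    ∃ w ∈ U, ∀ x ∈ U, ∀ y ∈ U, H.Adj w x → H.Adj w y → x = y := by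
  classical
  have hac : (H.induce (U : Set W)).IsAcyclic :=
    hH.comap (induceHomOfLE H hU).toHom (induceHomOfLE H hU).injective
  obtain ⟨w₀, hw₀⟩ := hne
  have : Nonempty (U : Set W) := ⟨⟨w₀, hw₀⟩⟩
  -- Extend the forest on `U` to a tree on `U`; a leaf of the tree has at most one neighbour in the
  -- forest.
  obtain ⟨T, hT, -, hTt⟩ :=
    (connected_top (V := (U : Set W))).exists_isTree_le_of_le_of_isAcyclic le_top hac
  rcases subsingleton_or_nontrivial (U : Set W) with hs | hs
  · exact ⟨w₀, hw₀, fun x hx y hy _ _ =>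
      congrArg Subtype.val (Subsingleton.elim (⟨x, hx⟩ : (U : Set W)) ⟨y, hy⟩)⟩
  · obtain ⟨w, hw⟩ := hTt.exists_vert_degree_one_of_nontrivial
    rw [degree_eq_one_iff_existsUnique_adj] at hw
    refine ⟨w, w.2, fun x hx y hy hwx hwy => ?_⟩
    exact congrArg Subtype.val (hw.unique (y₁ := ⟨x, hx⟩) (y₂ := ⟨y, hy⟩)
      (hT (by simpa using hwx)) (hT (by simpa using hwy)))

/-- In the presence of a haven of order `n + 1`, every forest with at most `n` vertices has a model
whose branch sets all attach to a connected set outside of the model. -/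
theorem IsHaven.exists_model {n : ℕ} {B : Set (Finset V)} (hB : G.IsHaven n B) {W : Type v}
    {H : SimpleGraph W} {s : Set W} (hH : (H.induce s).IsAcyclic) (U : Finset W)
    (hU : (U : Set W) ⊆ s) (hUn : U.card ≤ n) :
    ∃ (C : Finset V) (f : W → Finset V), C ∈ B ∧ G.IsConn C ∧ (G.nbr C).card = U.card ∧
      (∀ D ∈ B, G.IsConn D → D ⊂ C → (G.nbr C).card < (G.nbr D).card) ∧
      (∀ a ∈ U, G.IsConn (f a) ∧ Disjoint (f a) C ∧ ∃ x ∈ f a, x ∈ G.nbr C) ∧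
      (∀ a ∈ U, ∀ b ∈ U, ∀ x, x ∈ f a → x ∈ f b → a = b) ∧
      ∀ a ∈ U, ∀ b ∈ U, H.Adj a b → ∃ x ∈ f a, ∃ y ∈ f b, G.Adj x y := by
  classical
  induction hk : U.card generalizing U with
  | zero =>
    obtain rfl := Finset.card_eq_zero.1 hk
    obtain ⟨C₀, hC₀B, hC₀c, -, hC₀N⟩ := hB.exists_component ∅ (by simp)
    obtain ⟨C, -, ⟨hCB, hCc, hCN⟩, hmin⟩ := exists_minimal_le_of_wellFoundedLT
      (fun X : Finset V => X ∈ B ∧ G.IsConn X ∧ (G.nbr X).card = 0) C₀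
      ⟨hC₀B, hC₀c, by rw [Finset.subset_empty.1 hC₀N, Finset.card_empty]⟩
    refine ⟨C, fun _ => ∅, hCB, hCc, hCN, fun D hDB hDc hD => ?_, by simp, by simp, by simp⟩
    by_contra hlt
    exact hD.not_ge (hmin ⟨hDB, hDc, by omega⟩ hD.le)
  | succ k ih =>
    obtain ⟨w, hw, hw1⟩ := exists_at_most_one_adj hH hU (Finset.card_pos.1 (by omega))
    have hcard : (U.erase w).card = k := by rw [Finset.card_erase_of_mem hw, hk]; rfl
    obtain ⟨C, f, hCB, hCc, hCN, hCmin, hf, hfd, hfa⟩ := ih (U.erase w)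
      ((Finset.coe_subset.2 (Finset.erase_subset _ _)).trans hU) (by omega) hcard
    have hNV : Nonempty V := ⟨hCc.1.choose⟩
    have hroot : ∀ a ∈ U.erase w, ∃ x, x ∈ f a ∧ x ∈ G.nbr C := fun a ha => (hf a ha).2.2
    choose! r hrf hrN using hroot
    -- `C` has exactly as many neighbours as there are branch sets, and each branch set contains
    -- one.
    have hruniq : ∀ a ∈ U.erase w, ∀ x ∈ f a, x ∈ G.nbr C → x = r a := fun a ha x hx hxN =>
      (meet_unique_of_disjoint (I := U.erase w) (M := f) hfd (fun a ha => (hf a ha).2.2)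
        (by omega)).2 a ha x hxN (r a) (hrN a ha) hx (hrf a ha)
    -- The seed of the new branch set: a neighbour in `C` of the root of the unique earlier
    -- neighbour of `w`, or any vertex of `C` if there is none.
    obtain ⟨v, hvC, hv⟩ : ∃ v ∈ C, ∀ a ∈ U.erase w, H.Adj w a → G.Adj v (r a) := by
      by_cases hp : ∃ p ∈ U.erase w, H.Adj w p
      · obtain ⟨p, hp, hwp⟩ := hp
        obtain ⟨-, v, hv, hvr⟩ := mem_nbr.1 (hrN p hp)
        refine ⟨v, hv, fun a ha hwa => ?_⟩
        rwa [hw1 a (Finset.mem_of_mem_erase ha) p (Finset.mem_of_mem_erase hp) hwa hwp]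
      · push Not at hp
        obtain ⟨v, hv⟩ := hCc.1
        exact ⟨v, hv, fun a ha hwa => (hp a ha hwa).elim⟩
    obtain ⟨C', hC'B, hC'c, hC'C, hC'N, hC'min, M, hM, hMd⟩ :=
      hB.exists_of_minimal hCB (by rwa [hCN] at *) (by omega) hvC
    have hrM : ∀ a ∈ U.erase w, r a ∈ insert v (G.nbr C) := fun a ha =>
      Finset.mem_insert_of_mem (hrN a ha)
    have hvM : v ∈ insert v (G.nbr C) := Finset.mem_insert_self _ _
    have hfM : ∀ a ∈ U.erase w, ∀ t ∈ insert v (G.nbr C), ∀ x, x ∈ f a → x ∈ M t → t = r a := by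
      intro a ha t ht x hx hxt
      have hxN : x ∈ G.nbr C := by
        refine (Finset.mem_union.1 ((hM t ht).2.2.1 hxt)).resolve_left fun hxC => ?_
        exact Finset.disjoint_left.1 (hf a ha).2.1 hx hxC
      rw [← hruniq a ha x hx hxN]
      exact ((hM t ht).2.2.2.2.2 x (Finset.mem_insert_of_mem hxN) hxt).symm
    have hrinj : ∀ a ∈ U.erase w, ∀ b ∈ U.erase w, r a = r b → a = b := fun a ha b hb hab =>
      hfd a ha b hb (r a) (hrf a ha) (hab ▸ hrf b hb)
    have hrv : ∀ a ∈ U.erase w, r a ≠ v := fun a ha h =>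
      (mem_nbr.1 (hrN a ha)).1 (h ▸ hvC)
    have hMr : ∀ a ∈ U.erase w, ∀ x, x ∈ f a ∪ M (r a) → x ∉ M v := by
      intro a ha x hx hxv
      rcases Finset.mem_union.1 hx with h | h
      · exact hrv a ha (hfM a ha v hvM x h hxv).symm
      · exact hrv a ha (hMd _ (hrM a ha) v hvM x h hxv)
    have herase : ∀ a ∈ U, a ≠ w → a ∈ U.erase w := fun a ha hne => Finset.mem_erase.2 ⟨hne, ha⟩
    refine ⟨C', fun a => if a = w then M v else f a ∪ M (r a), hC'B, hC'c, by omega, hC'min,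
      fun a ha => ?_, fun a ha b hb x hxa hxb => ?_, fun a ha b hb hab => ?_⟩
    · by_cases haw : a = w
      · obtain ⟨-, h2, -, h4, h5, -⟩ := hM v hvM
        simp only [haw, if_true]
        exact ⟨h2, h4, h5⟩
      · have ha' := herase a ha haw
        obtain ⟨h1, h2, -, h4, ⟨x, hx, hxN⟩, -⟩ := hM _ (hrM a ha')
        simp only [haw, if_false]
        refine ⟨?_, ?_, ⟨x, Finset.mem_union_right _ hx, hxN⟩⟩
        · rw [Finset.coe_union]
          exact (hf a ha').1.union_of_mem h2 (hrf a ha') h1 (Or.inl rfl)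
        · exact Finset.disjoint_union_left.2 ⟨(hf a ha').2.1.mono_right hC'C, h4⟩
    · by_cases haw : a = w <;> by_cases hbw : b = w <;>
        simp only [haw, hbw, if_true, if_false] at hxa hxb
      · rw [haw, hbw]
      · exact absurd hxa (hMr b (herase b hb hbw) x hxb)
      · exact absurd hxb (hMr a (herase a ha haw) x hxa)
      · have ha' := herase a ha haw
        have hb' := herase b hb hbw
        rcases Finset.mem_union.1 hxa with h | h <;> rcases Finset.mem_union.1 hxb with h' | h'
        · exact hfd a ha' b hb' x h h'
        · exact hrinj a ha' b hb' (hfM a ha' _ (hrM b hb') x h h').symm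
        · exact hrinj a ha' b hb' (hfM b hb' _ (hrM a ha') x h' h)
        · exact hrinj a ha' b hb' (hMd _ (hrM a ha') _ (hrM b hb') x h h')
    · by_cases haw : a = w <;> by_cases hbw : b = w <;> simp only [haw, hbw, if_true, if_false]
      · rw [haw, hbw] at hab; exact (hab.ne rfl).elim
      · have hb' := herase b hb hbw
        exact ⟨v, (hM v hvM).1, r b, Finset.mem_union_left _ (hrf b hb'), hv b hb' (haw ▸ hab)⟩
      · have ha' := herase a ha haw
        exact ⟨r a, Finset.mem_union_left _ (hrf a ha'), v, (hM v hvM).1,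
          (hv a ha' (hbw ▸ hab.symm)).symm⟩
      · obtain ⟨x, hx, y, hy, hxy⟩ := hfa a (herase a ha haw) b (herase b hb hbw) hab
        exact ⟨x, Finset.mem_union_left _ hx, y, Finset.mem_union_left _ hy, hxy⟩

end Model

/-! ### From branch sets to sequences of minor operations -/

section Minor

/-- The fibres of `φ` over `W` are the branch sets of a model of `H` in `G`. -/
structure IsModel {V : Type u} {W : Type v} (G : SimpleGraph V) (H : SimpleGraph W)
    (φ : V → Option W) : Prop where
  conn : ∀ w, G.IsConn {x | φ x = some w}
  adj : ∀ a b, H.Adj a b → ∃ x y, φ x = some a ∧ φ y = some b ∧ G.Adj x y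

variable {V : Type u} {W : Type v} {G : SimpleGraph V} {H : SimpleGraph W} {φ : V → Option W}

theorem IsModel.induce (h : G.IsModel H φ) {a : V} (ha : φ a = none) :
    (G.induce {x | x ≠ a}).IsModel H fun x => φ x := by
  have hne : ∀ {x w}, φ x = some w → x ≠ a := by
    rintro x w hx rfl
    simp [ha] at hx
  refine ⟨fun w => ⟨?_, fun p ⟨x, hx, hxp⟩ hc y hy => ?_⟩, fun c d hcd => ?_⟩
  · obtain ⟨x, hx⟩ := (h.conn w).1
    exact ⟨⟨x, hne hx⟩, hx⟩
  · have := (h.conn w).2 (Subtype.val '' p) ⟨x, hx, x, hxp, rfl⟩ (by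
      rintro _ hb c hc' hbc ⟨b, hbp, rfl⟩
      exact ⟨⟨c, hne hc'⟩, hc b hb ⟨c, hne hc'⟩ hc' (by simpa using hbc) hbp, rfl⟩) hy
    obtain ⟨z, hz, hzy⟩ := this
    rwa [← Subtype.ext hzy]
  · obtain ⟨x, y, hx, hy, hxy⟩ := h.adj c d hcd
    exact ⟨⟨x, hne hx⟩, ⟨y, hne hy⟩, hx, hy, by simpa using hxy⟩

theorem IsModel.contractEdge (h : G.IsModel H φ) {a b : V} (hab : G.Adj a b) (hφ : φ a = φ b) :
    (G.contractEdge a b).IsModel H fun x => φ x := by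
  classical
  -- The contraction map. It preserves `φ` because `a` and `b` lie in the same fibre, so
  -- connectedness and adjacency are transported along it.
  let π : V → {x : V // x ≠ b} := fun x => if hx : x = b then ⟨a, hab.ne⟩ else ⟨x, hx⟩
  have hπb : π b = ⟨a, hab.ne⟩ := by simp [π]
  have hπ : ∀ x (hx : x ≠ b), π x = ⟨x, hx⟩ := fun x hx => by simp [π, hx]
  have hφπ : ∀ x, φ (π x) = φ x := by
    intro x
    by_cases hx : x = b
    · rw [hx, hπb, hφ]
    · rw [hπ x hx]
  have hadj : ∀ x y, G.Adj x y → π x ≠ π y → (G.contractEdge a b).Adj (π x) (π y) := by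
    intro x y hxy hne
    refine (fromRel_adj _ _ _).2 ⟨hne, ?_⟩
    by_cases hx : x = b
    · have hy : y ≠ b := fun hy => hne (by rw [hx, hy])
      rw [hx] at hxy ⊢
      rw [hπb, hπ y hy]
      exact Or.inl (Or.inr ⟨rfl, hxy⟩)
    · by_cases hy : y = b
      · rw [hy] at hxy ⊢
        rw [hπb, hπ x hx]
        exact Or.inr (Or.inr ⟨rfl, hxy.symm⟩)
      · rw [hπ x hx, hπ y hy]
        exact Or.inl (Or.inl hxy)
  refine ⟨fun w => ⟨?_, fun p ⟨x, hx, hxp⟩ hc y hy => ?_⟩, fun c d hcd => ?_⟩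
  · obtain ⟨x, hx⟩ := (h.conn w).1
    exact ⟨π x, (hφπ x).trans hx⟩
  · have := (h.conn w).2 (π ⁻¹' p) ⟨x, hx, by rwa [Set.mem_preimage, hπ x x.2]⟩
      (fun s hs t ht hst hsp => by
        by_cases hne : π s = π t
        · rwa [Set.mem_preimage, ← hne]
        · exact hc _ ((hφπ s).trans hs) _ ((hφπ t).trans ht) (hadj s t hst hne) hsp) hy
    rwa [Set.mem_preimage, hπ y y.2] at this
  · obtain ⟨x, y, hx, hy, hxy⟩ := h.adj c d hcd
    refine ⟨π x, π y, (hφπ x).trans hx, (hφπ y).trans hy, hadj x y hxy fun he => ?_⟩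
    have := (hφπ x).symm.trans ((congrArg (fun z : {x : V // x ≠ b} => φ z) he).trans (hφπ y))
    rw [hx, hy] at this
    exact hcd.ne (Option.some_injective _ this)

/-- Surplus edges are deleted one at a time until `e` is an isomorphism. -/
theorem isMinorOf_of_bijective (e : V ≃ W) (h : ∀ x y, H.Adj (e x) (e y) → G.Adj x y) [Finite V] :
    H.IsMinorOf G := by
  induction G using WellFoundedLT.induction with
  | ind G ih =>
  by_cases hG : ∀ x y, G.Adj x y → H.Adj (e x) (e y)
  · exact .of_iso ⟨e, fun {x y} => ⟨h x y, hG x y⟩⟩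
  push Not at hG
  obtain ⟨x, y, hxy, hn⟩ := hG
  refine .of_deleteEdge s(x, y) hxy (ih _ ?_ fun a b hab => ?_)
  · refine lt_of_le_of_ne (deleteEdges_le _) fun he => ?_
    have : (G.deleteEdges {s(x, y)}).Adj x y := by rw [he]; exact hxy
    simp [deleteEdges_adj] at this
  · refine deleteEdges_adj.2 ⟨h a b hab, fun he => ?_⟩
    rcases Sym2.eq_iff.1 (Set.mem_singleton_iff.1 he) with ⟨rfl, rfl⟩ | ⟨rfl, rfl⟩
    · exact hn hab
    · exact hn hab.symm

/-- Each step loses one vertex: delete a vertex outside the model or contract an edge inside a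
fibre. When neither is possible, `φ` is a bijection and only edges remain to be deleted. -/
theorem IsModel.isMinorOf_aux (n : ℕ) : ∀ {V : Type u} [Finite V] {G : SimpleGraph V}
    {φ : V → Option W}, G.IsModel H φ → Nat.card V = n → H.IsMinorOf G := by
  induction n with
  | zero =>
    intro V _ G φ h hV
    have := (Nat.card_eq_zero.1 hV).resolve_right (fun h => h.not_finite inferInstance)
    have hW : IsEmpty W := ⟨fun w => this.false (h.conn w).1.choose⟩
    exact isMinorOf_of_bijective (Equiv.equivOfIsEmpty V W) fun x => (this.false x).elim
  | succ n ih =>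
    intro V _ G φ h hV
    have hcard : ∀ a : V, Nat.card {x : V // x ≠ a} = n := by
      intro a
      classical
      have := Fintype.ofFinite V
      rw [Nat.card_eq_fintype_card] at hV ⊢
      rw [Fintype.card_subtype_compl, hV, Fintype.card_subtype_eq]
      rfl
    by_cases hnone : ∃ a, φ a = none
    · obtain ⟨a, ha⟩ := hnone
      exact .of_deleteVertex a (ih (h.induce ha) (hcard a))
    by_cases hinj : ∀ a b, φ a = φ b → a = b
    · push Not at hnone
      choose e he using fun a => Option.ne_none_iff_exists'.1 (hnone a)
      have hbij : Function.Bijective e := by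
        refine ⟨fun a b hab => hinj a b (by rw [he, he, hab]), fun w => ?_⟩
        obtain ⟨x, hx⟩ := (h.conn w).1
        exact ⟨x, Option.some_injective _ ((he x).symm.trans hx)⟩
      refine isMinorOf_of_bijective (Equiv.ofBijective e hbij) fun x y hxy => ?_
      obtain ⟨x', y', hx', hy', hxy'⟩ := h.adj _ _ hxy
      rw [hinj x x' ((he x).trans hx'.symm), hinj y y' ((he y).trans hy'.symm)]
      exact hxy'
    · push Not at hinj
      obtain ⟨a, b, hab, hne⟩ := hinj
      obtain ⟨w, hw⟩ := Option.ne_none_iff_exists'.1 fun hn => hnone ⟨a, hn⟩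
      obtain ⟨x, hx, y, hy, hxy, -, -⟩ := (h.conn w).exists_adj_of_not_subset (p := {a})
        ⟨a, hw, rfl⟩ ⟨b, hab.symm.trans hw, fun h => hne h.symm⟩
      exact .of_contractEdge x y hxy
        (ih (h.contractEdge hxy (Eq.trans hx (Eq.symm hy))) (hcard y))

theorem IsModel.isMinorOf [Finite V] (h : G.IsModel H φ) : H.IsMinorOf G :=
  IsModel.isMinorOf_aux _ h rfl

/-- A graph with disjoint connected branch sets for the vertices of `H`, adjacent where `H`
requires it, contains `H` as a minor. -/
theorem isMinorOf_of_branchSets [Finite V] (f : W → Set V) (hc : ∀ w, G.IsConn (f w))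
    (hd : ∀ a b x, x ∈ f a → x ∈ f b → a = b)
    (hadj : ∀ a b, H.Adj a b → ∃ x ∈ f a, ∃ y ∈ f b, G.Adj x y) : H.IsMinorOf G := by
  classical
  let φ : V → Option W := fun x => if h : ∃ w, x ∈ f w then some h.choose else none
  have hφ : ∀ x w, φ x = some w ↔ x ∈ f w := by
    intro x w
    constructor
    · intro hx
      by_cases h : ∃ w, x ∈ f w
      · simp only [φ, h, dif_pos, Option.some.injEq] at hx
        rw [← hx]; exact h.choose_spec
      · simp [φ, h] at hx
    · intro hx
      have h : ∃ w, x ∈ f w := ⟨w, hx⟩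
      simp only [φ, h, dif_pos, Option.some.injEq]
      exact hd _ _ x h.choose_spec hx
  refine IsModel.isMinorOf (φ := φ) ⟨fun w => ?_, fun a b hab => ?_⟩
  · simp only [hφ]
    exact hc w
  · obtain ⟨x, hx, y, hy, hxy⟩ := hadj a b hab
    exact ⟨x, y, (hφ x a).2 hx, (hφ y b).2 hy, hxy⟩

theorem IsMinorOf.card_le (h : H.IsMinorOf G) [Finite V] : Nat.card W ≤ Nat.card V := by
  rename_i hV
  revert hV
  induction h with
  | of_iso e => exact (Nat.card_congr e.toEquiv).ge
  | of_deleteVertex a _ ih => exact ih.trans (Finite.card_subtype_le _)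
  | of_deleteEdge _ _ _ ih => exact ih
  | of_contractEdge a b _ _ ih => exact ih.trans (Finite.card_subtype_le _)

end Minor

/-! ### Helly property of subtrees and the tree-width of complete graphs -/

section Helly

variable {N : Type u} {T : SimpleGraph N}

/-- Paths in a forest are unique, and a walk inside `s` shortens to a path inside `s`. -/
theorem IsConn.mem_of_mem_path {s : Set N} (hs : T.IsConn s) (hT : T.IsAcyclic) {a b : N}
    (ha : a ∈ s) (hb : b ∈ s) {p : T.Walk a b} (hp : p.IsPath) {x : N} (hx : x ∈ p.support) :
    x ∈ s := by
  classical
  obtain ⟨w⟩ := (isConn_iff_connected_induce.1 hs).preconnected ⟨a, ha⟩ ⟨b, hb⟩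
  let q : T.Walk a b := w.map (Embedding.induce s).toHom
  have hpq : p = q.bypass :=
    congrArg Subtype.val
      ((hT.subsingleton_path a b).elim ⟨p, hp⟩ ⟨q.bypass, q.bypass_isPath⟩)
  rw [hpq] at hx
  have := q.support_bypass_subset_support hx
  rw [show q.support = _ from Walk.support_map _ _] at this
  obtain ⟨y, -, rfl⟩ := List.mem_map.1 this
  exact y.2

theorem IsConn.exists_path {s : Set N} (hs : T.IsConn s) {a b : N}
    (ha : a ∈ s) (hb : b ∈ s) : ∃ p : T.Walk a b, p.IsPath := by
  classical
  obtain ⟨w⟩ := (isConn_iff_connected_induce.1 hs).preconnected ⟨a, ha⟩ ⟨b, hb⟩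
  let q : T.Walk a b := w.map (Embedding.induce s).toHom
  exact ⟨q.bypass, q.bypass_isPath⟩

theorem IsConn.inter_of_isAcyclic {s t : Set N} (hT : T.IsAcyclic) (hs : T.IsConn s)
    (ht : T.IsConn t) (hst : (s ∩ t).Nonempty) : T.IsConn (s ∩ t) := by
  refine ⟨hst, fun p ⟨x, hx, hxp⟩ hc y hy => ?_⟩
  obtain ⟨w, hw⟩ := hs.exists_path hx.1 hy.1
  have hmem : ∀ z ∈ w.support, z ∈ s ∩ t := fun z hz =>
    ⟨hs.mem_of_mem_path hT hx.1 hy.1 hw hz, ht.mem_of_mem_path hT hx.2 hy.2 hw hz⟩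
  have key : ∀ {a b : N} (w : T.Walk a b), (∀ z ∈ w.support, z ∈ s ∩ t) → a ∈ p → b ∈ p := by
    intro a b w
    induction w with
    | nil => exact fun _ => id
    | cons hab w ih =>
      intro hm ha
      refine ih (fun z hz => hm z (by simp [hz])) (hc _ (hm _ (by simp)) _ (hm _ (by simp)) hab ha)
  exact key w hmem hxp

/-- If no common node existed, the connected set `s₁ ∩ (s₂ ∪ s₃)` would contain an edge `xy` with `x
∈ s₂` and `y ∈ s₃ \ s₂`. The path from `y` through `x` and then within `s₂` to `b ∈ s₂ ∩ s₃` has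
both ends in `s₃`, so `x` lies in all three sets. -/
theorem IsAcyclic.exists_mem_inter {s₁ s₂ s₃ : Set N} (hT : T.IsAcyclic) (h₁ : T.IsConn s₁)
    (h₂ : T.IsConn s₂) (h₃ : T.IsConn s₃) (h₁₂ : (s₁ ∩ s₂).Nonempty) (h₂₃ : (s₂ ∩ s₃).Nonempty)
    (h₁₃ : (s₁ ∩ s₃).Nonempty) : ∃ x, x ∈ s₁ ∧ x ∈ s₂ ∧ x ∈ s₃ := by
  by_contra! hno
  obtain ⟨a, ha₁, ha₂⟩ := h₁₂
  obtain ⟨b, hb₂, hb₃⟩ := h₂₃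
  obtain ⟨c, hc₁, hc₃⟩ := h₁₃
  have hu : T.IsConn (s₁ ∩ (s₂ ∪ s₃)) := h₁.inter_of_isAcyclic hT
    (h₂.union_of_mem h₃ hb₂ hb₃ (Or.inl rfl)) ⟨a, ha₁, Or.inl ha₂⟩
  obtain ⟨x, hx, y, hy, hxy, hx₂, hy₂⟩ := hu.exists_adj_of_not_subset (p := s₂)
    ⟨a, ⟨ha₁, Or.inl ha₂⟩, ha₂⟩ ⟨c, ⟨hc₁, Or.inr hc₃⟩, fun h => hno c hc₁ h hc₃⟩
  have hy₃ : y ∈ s₃ := hy.2.resolve_left hy₂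
  obtain ⟨p, hp⟩ := h₂.exists_path hx₂ hb₂
  have hp' : (Walk.cons hxy.symm p).IsPath :=
    hp.cons fun h => hy₂ (h₂.mem_of_mem_path hT hx₂ hb₂ hp h)
  exact hno x hx.1 hx₂ (h₃.mem_of_mem_path hT hy₃ hb₃ hp' (by simp))

/-- The **Helly property** of subtrees of a tree. -/
theorem IsAcyclic.exists_forall_mem [Nonempty N] {ι : Type*} (hT : T.IsAcyclic) (K : Finset ι)
    (F : ι → Set N) (hF : ∀ i ∈ K, T.IsConn (F i))
    (hFF : ∀ i ∈ K, ∀ j ∈ K, (F i ∩ F j).Nonempty) : ∃ t, ∀ i ∈ K, t ∈ F i := by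
  classical
  induction K using Finset.induction_on generalizing F with
  | empty => exact ⟨Classical.arbitrary N, by simp⟩
  | insert i K hi ih =>
    have hiK : i ∈ insert i K := Finset.mem_insert_self i K
    have hK : ∀ j ∈ K, j ∈ insert i K := fun j => Finset.mem_insert_of_mem
    rcases K.eq_empty_or_nonempty with rfl | ⟨j₀, hj₀⟩
    · obtain ⟨t, ht⟩ := (hF i hiK).1
      exact ⟨t, by simpa using ht⟩
    -- Intersecting with `F i` keeps the sets connected, and the case of three sets keeps them
    -- pairwise intersecting.
    · obtain ⟨t, ht⟩ := ih (fun j => F j ∩ F i)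
        (fun j hj => (hF j (hK j hj)).inter_of_isAcyclic hT (hF i hiK) (hFF j (hK j hj) i hiK))
        (fun j hj l hl => by
          obtain ⟨t, h1, h2, h3⟩ := hT.exists_mem_inter (hF j (hK j hj)) (hF l (hK l hl)) (hF i hiK)
            (hFF j (hK j hj) l (hK l hl)) (hFF l (hK l hl) i hiK) (hFF j (hK j hj) i hiK)
          exact ⟨t, ⟨h1, h3⟩, h2, h3⟩)
      refine ⟨t, fun l hl => ?_⟩
      rcases Finset.mem_insert.1 hl with rfl | hl
      · exact (ht j₀ hj₀).2
      · exact (ht l hl).1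

/-- The node sets of any two vertices meet since the vertices are adjacent, so by Helly one bag
contains all vertices; a single bag attains the bound. -/
theorem treewidth_top (V : Type u) [Fintype V] :
    (⊤ : SimpleGraph V).treewidth = (Fintype.card V : ℤ) - 1 := by
  classical
  apply le_antisymm
  · have : (⊤ : SimpleGraph V).treewidth < Fintype.card V :=
      treewidth_lt_of_decomposes ⟨_, inferInstance, _, _, IsDecOn.single _ Finset.univ, fun t =>
        ⟨∅, rfl, by simp, by simp, by simp [Finset.card_univ]⟩⟩
    omega
  · obtain ⟨D, hD⟩ := (isLeast_treewidth (⊤ : SimpleGraph V)).1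
    have := D.isTree.connected.nonempty
    obtain ⟨t, ht⟩ := D.isTree.isAcyclic.exists_forall_mem Finset.univ
      (fun x => {t | x ∈ D.bag t}) (fun x _ => isConn_iff_connected_induce.2 (D.connected_induce x))
      (fun x _ y _ => by
        by_cases hxy : x = y
        · obtain ⟨t, ht⟩ := D.exists_mem_bag x
          exact ⟨t, ht, hxy ▸ ht⟩
        · exact D.exists_adj_mem_bag x y hxy)
    have hbag : D.bag t = Finset.univ := Finset.eq_univ_iff_forall.2 fun x => ht x (Finset.mem_univ x)
    have h1 : (D.bag t).card ≤ Finset.univ.sup fun t : D.Node => (D.bag t).card :=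
      Finset.le_sup (f := fun t : D.Node => (D.bag t).card) (Finset.mem_univ t)
    rw [hbag, Finset.card_univ] at h1
    have h3 : D.width = ((Finset.univ.sup fun t : D.Node => (D.bag t).card : ℕ) : ℤ) - 1 := rfl
    omega

end Helly

/-! ### The theorem and its sharpness -/

/-- Every graph of tree-width at least `|V(H)| - 1` contains the apex-forest `H` as a minor. -/
theorem IsApexForest.isMinorOf {W : Type v} [Fintype W] {H : SimpleGraph W} (hH : H.IsApexForest)
    {V : Type u} [Finite V] {G : SimpleGraph V} (hG : (Fintype.card W : ℤ) - 1 ≤ G.treewidth) :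
    H.IsMinorOf G := by
  classical
  have := Fintype.ofFinite V
  rcases isEmpty_or_nonempty W with hW | ⟨⟨w₀⟩⟩
  · exact isMinorOf_of_branchSets (fun w => hW.elim w) (fun w => hW.elim w) (fun w => hW.elim w)
      (fun w => hW.elim w)
  obtain ⟨s, hs, hac⟩ := hH
  -- If `H` is already a forest, any vertex may play the apex.
  obtain ⟨a, ha⟩ : ∃ a, s ⊆ {a} := by
    rcases hs.eq_empty_or_singleton with rfl | ⟨a, rfl⟩
    · exact ⟨w₀, Set.empty_subset _⟩
    · exact ⟨a, subset_rfl⟩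
  have hcard : (Finset.univ.erase a).card = Fintype.card W - 1 := by
    rw [Finset.card_erase_of_mem (Finset.mem_univ a), Finset.card_univ]
  have hpos : 0 < Fintype.card W := Fintype.card_pos_iff.2 ⟨a⟩
  obtain ⟨B, hB⟩ := exists_isHaven (G := G) (n := Fintype.card W - 1) fun h => by
    have := treewidth_lt_of_decomposes h
    omega
  obtain ⟨C, f, -, hCc, -, -, hf, hfd, hfa⟩ := hB.exists_model hac (Finset.univ.erase a)
    (fun x hx hxs => Finset.ne_of_mem_erase hx (ha hxs)) hcard.le
  have hmem : ∀ w, w ≠ a → w ∈ Finset.univ.erase a := fun w hw =>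
    Finset.mem_erase.2 ⟨hw, Finset.mem_univ w⟩
  have hroot : ∀ w, w ≠ a → ∃ x ∈ C, ∃ y ∈ f w, G.Adj x y := by
    intro w hw
    obtain ⟨y, hy, hyN⟩ := (hf w (hmem w hw)).2.2
    obtain ⟨-, x, hx, hxy⟩ := mem_nbr.1 hyN
    exact ⟨x, hx, y, hy, hxy⟩
  -- `C` is adjacent to all branch sets, so it can represent the apex whatever its neighbours in `H`
  -- are.
  refine isMinorOf_of_branchSets (fun w => if w = a then (C : Set V) else f w) (fun w => ?_)
    (fun b c x hxb hxc => ?_) (fun b c hbc => ?_)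
  · by_cases hw : w = a
    · simpa [hw] using hCc
    · simpa [hw] using (hf w (hmem w hw)).1
  · by_cases hb : b = a <;> by_cases hc : c = a <;>
      simp only [hb, hc, if_true, if_false, Finset.mem_coe] at hxb hxc
    · rw [hb, hc]
    · exact absurd hxb (Finset.disjoint_left.1 (hf c (hmem c hc)).2.1 hxc)
    · exact absurd hxc (Finset.disjoint_left.1 (hf b (hmem b hb)).2.1 hxb)
    · exact hfd b (hmem b hb) c (hmem c hc) x hxb hxc
  · by_cases hb : b = a <;> by_cases hc : c = a <;>
      simp only [hb, hc, if_true, if_false, Finset.mem_coe]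
    · exact (hbc.ne (hb.trans hc.symm)).elim
    · exact hroot c hc
    · obtain ⟨x, hx, y, hy, hxy⟩ := hroot b hb
      exact ⟨y, hy, x, hx, hxy.symm⟩
    · exact hfa b (hmem b hb) c (hmem c hc) hbc

end SimpleGraph

theorem theorem1 {W : Type v} [Fintype W] (H : SimpleGraph W) (hH : H.IsApexForest) :
    (∀ (V : Type u) [Finite V] (G : SimpleGraph V),
      (Fintype.card W : ℤ) - 1 ≤ G.treewidth → H.IsMinorOf G) ∧
    (Nonempty W →
      IsLeast {k : ℤ | SimpleGraph.TreewidthForcesMinor.{u, v} H k} ((Fintype.card W : ℤ) - 1) ∧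
      (⊤ : SimpleGraph (Fin (Fintype.card W - 1))).treewidth = (Fintype.card W : ℤ) - 2 ∧
      ¬ H.IsMinorOf (⊤ : SimpleGraph (Fin (Fintype.card W - 1)))) := by
  refine ⟨fun V _ G hG => hH.isMinorOf hG, fun hW => ?_⟩
  have hpos : 0 < Fintype.card W := Fintype.card_pos
  refine ⟨⟨fun V _ G hG => hH.isMinorOf hG, fun k hk => ?_⟩, ?_, fun h => ?_⟩
  · by_contra hlt
    -- The complete graph on `|V(H)| - 1` vertices, lifted to the universe of the host graphs, has
    -- tree-width at least `k`; a minor cannot have more vertices than its host.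
    have hm := hk (ULift.{u} (Fin (Fintype.card W - 1))) ⊤ (by
      rw [SimpleGraph.treewidth_top, Fintype.card_ulift, Fintype.card_fin]; omega)
    have := hm.card_le
    rw [Nat.card_eq_fintype_card, Nat.card_eq_fintype_card, Fintype.card_ulift,
      Fintype.card_fin] at this
    omega
  · rw [SimpleGraph.treewidth_top, Fintype.card_fin]; omega
  · have := h.card_le
    rw [Nat.card_eq_fintype_card, Nat.card_eq_fintype_card, Fintype.card_fin] at this
    omega
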